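/- **Normal form theorem in positive characteristic.** Let $p$ be a prime and let $k$ be an algebraically closed field of characteristic $p$. *The ring $R$.* Let $k(z)=k(z_1,z_2,\ldots)$ and let $R=\bigoplus_{\sigma\in k}t^\sigma\,k(z)((x))$ be the group algebra of the additive group of $k$ over $k(z)((x))$, so that $t^\sigma t^\tau=t^{\sigma+\tau}$. Equip $R$ with the derivation $\partial$ that acts coefficientwise on Laurent series and satisfies $\partial x=1$, $\partial t^\sigma=\sigma t^\sigma x^{-1}$ and $\partial z_j=\frac{1}{x\,z_1\cdots z_{j-1}}$ for $j\ge 1$. Let $\mathcal C=\{c\in R:\partial c=0\}$ be its ring of constants. *The operator.* Let $L=\sum_j\sum_{i\ge 0}c_{ij}x^i\partial^j\in k[[x]][\partial]$ (a finite sum over $j$) be an operator of shift $0$, i.e. $\min\{i-j: c_{ij}\neq 0\}=0$, with initial form $L_0=\sum_j c_{jj}x^j\partial^j$ and indicial polynomial $\chi(s)=\sum_j c_{jj}\,s(s-1)\cdots(s-j+1)$; $L$ and $L_0$ act on $R$. Write $m_\sigma\ge 0$ for the multiplicity of $\sigma\in k$ as a root of $\chi$, and let $\rho\in k$ be a local exponent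 of $L$, i.e. a root of $\chi$. *The spaces.* For $n\ge0$ put $\xi(n)=m_\rho+m_{\rho+1}+\cdots+m_{\rho+n}$, and let $\mathcal A_n$ be the set of finitely supported sequences $\alpha=(\alpha_1,\alpha_2,\ldots)$ of natural numbers with $\alpha_1<\xi(n)$ and $\alpha_{j+1}\le\alpha_j/p$ for all $j\ge 1$. Put $e(\alpha)=\bar\alpha_1+p\bar\alpha_2+p^2\bar\alpha_3+\cdots$, where $\bar\alpha_i\in\{0,\ldots,p-1\}$ is the residue of $\alpha_i$ modulo $p$. Let $$F=t^\rho\sum_{n=0}^\infty\ \bigoplus_{\alpha\in\mathcal A_n}k\,z^\alpha x^n\subset R$$ (formal series in $x$), with the $x$-adic topology (given by the order in $x$), and let $H\subset F$ be the subspace of those series in which only monomials $t^\rho z^\alpha x^n$ with $e(\alpha)\ge m_{\rho+n}$ occur. A map $\varphi$ from a $k$-subspace $M$ of $R$ to $R$ is called $\mathcal C$-linear if $\varphi(g)=\sum_i c_i\varphi(f_i)$ whenever $g=\sum_i c_if_i$ is a finite sum with $g,f_i\in M$ and $c_i\in\mathcal C$ ($M$ itself need not be stable under multiplication by $\mathcal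 C$). Then: 0. $H$ is a direct complement in $F$ of the kernel of $L_0|_F$. 1. $L_0$ restricts to a bijection $H\to Fx$, and the inverse of this bijection, composed with the inclusion $H\subseteq F$, is a $\mathcal C$-linear right inverse $S:Fx\to F$ of $L_0$. 2. $T=L_0-L$ maps $F$ into $Fx$, and $u=\mathrm{Id}_F-S\circ T:F\to F$ is a continuous $\mathcal C$-linear automorphism of $F$ (bijective, with continuous $\mathcal C$-linear inverse) whose inverse is given by $u^{-1}(f)=\sum_{n=0}^\infty(S\circ T)^n(f)$, the series converging in $F$ for every $f\in F$. 3. $L\circ u^{-1}=L_0$ on $F$. -/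

import Mathlib

noncomputable section

namespace EulerClosure

/-- The field `k(z) = k(z₁, z₂, …)` of rational functions in countably many variables.
The index is shifted by one: the variable `z_{j+1}` has index `j`. -/
def ZField (k : Type*) [Field k] : Type _ := FractionRing (MvPolynomial ℕ k)

instance instFieldZField (k : Type*) [Field k] : Field (ZField k) :=
  inferInstanceAs (Field (FractionRing (MvPolynomial ℕ k)))

instance instAlgebraPolyZField (k : Type*) [Field k] : Algebra (MvPolynomial ℕ k) (ZField k) :=
  inferInstanceAs (Algebra (MvPolynomial ℕ k) (FractionRing (MvPolynomial ℕ k)))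

instance instAlgebraZField (k : Type*) [Field k] : Algebra k (ZField k) :=
  inferInstanceAs (Algebra k (FractionRing (MvPolynomial ℕ k)))

instance instIsFractionRingZField (k : Type*) [Field k] :
    IsFractionRing (MvPolynomial ℕ k) (ZField k) :=
  inferInstanceAs (IsFractionRing (MvPolynomial ℕ k) (FractionRing (MvPolynomial ℕ k)))

instance instIsScalarTowerZField (k : Type*) [Field k] :
    IsScalarTower k (MvPolynomial ℕ k) (ZField k) :=
  inferInstanceAs (IsScalarTower k (MvPolynomial ℕ k) (FractionRing (MvPolynomial ℕ k)))

instance instAlgebraLaurent (k : Type*) [Field k] : Algebra k (LaurentSeries (ZField k)) :=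
  HahnSeries.instAlgebra

/-- The ring `R = ⨁_{ρ ∈ k} t^ρ k(z)((x))`, as the group algebra of the additive group of `k`
over the field `k(z)((x))` of Laurent series; `t^ρ f` is `AddMonoidAlgebra.single ρ f`. -/
abbrev Closure (k : Type*) [Field k] : Type _ := AddMonoidAlgebra (LaurentSeries (ZField k)) k

/-- The variable `z_{j+1}` as an element of `k(z)`. -/
def zvar (k : Type*) [Field k] (j : ℕ) : ZField k :=
  algebraMap (MvPolynomial ℕ k) (ZField k) (MvPolynomial.X j)

/-- The monomial `z^α` for a multi-index `α` of natural numbers. -/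
def zmon (k : Type*) [Field k] (α : ℕ →₀ ℕ) : ZField k :=
  algebraMap (MvPolynomial ℕ k) (ZField k) (MvPolynomial.monomial α 1)

/-- `f ↦ f + ε D(f)` on polynomials, where `D(z_{j+1}) = 1 / (z₁ ⋯ z_j)`. -/
def polyLift (k : Type*) [Field k] :
    MvPolynomial ℕ k →ₐ[k] TrivSqZeroExt (ZField k) (ZField k) :=
  MvPolynomial.aeval fun j =>
    TrivSqZeroExt.inl (zvar k j) + TrivSqZeroExt.inr (∏ i ∈ Finset.range j, zvar k i)⁻¹

theorem fst_polyLift (k : Type*) [Field k] (f : MvPolynomial ℕ k) :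
    (polyLift k f).fst = algebraMap (MvPolynomial ℕ k) (ZField k) f := by
  have h : (TrivSqZeroExt.fstHom k (ZField k) (ZField k)).comp (polyLift k) =
      IsScalarTower.toAlgHom k (MvPolynomial ℕ k) (ZField k) := by
    apply MvPolynomial.algHom_ext
    intro j
    simp [polyLift, zvar]
  exact DFunLike.congr_fun h f

/-- The extension of `polyLift` to rational functions. -/
def ratLift (k : Type*) [Field k] :
    ZField k →ₐ[k] TrivSqZeroExt (ZField k) (ZField k) :=
  IsLocalization.liftAlgHom (M := nonZeroDivisors (MvPolynomial ℕ k)) (f := polyLift k) (by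
    intro y
    rw [TrivSqZeroExt.isUnit_iff_isUnit_fst, fst_polyLift]
    exact IsLocalization.map_units (ZField k) y)

theorem ratLift_algebraMap (k : Type*) [Field k] (f : MvPolynomial ℕ k) :
    ratLift k (algebraMap (MvPolynomial ℕ k) (ZField k) f) = polyLift k f := by
  simp [ratLift, IsLocalization.liftAlgHom_apply]

theorem fst_ratLift (k : Type*) [Field k] (f : ZField k) : (ratLift k f).fst = f := by
  have h : (TrivSqZeroExt.fstHom k (ZField k) (ZField k)).comp (ratLift k) =
      AlgHom.id k (ZField k) := by
    apply IsLocalization.algHom_ext (nonZeroDivisors (MvPolynomial ℕ k))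
    ext j : 1
    change (ratLift k (algebraMap _ _ (MvPolynomial.X j))).fst = algebraMap _ _ (MvPolynomial.X j)
    rw [ratLift_algebraMap, fst_polyLift]
  exact DFunLike.congr_fun h f

/-- The `k`-derivation `x∂` of the field `k(z)`; it sends `z_{j+1}` to `1 / (z₁ ⋯ z_j)`. -/
def zDeriv (k : Type*) [Field k] : Derivation k (ZField k) (ZField k) where
  toLinearMap := (TrivSqZeroExt.sndHom (ZField k) (ZField k)).restrictScalars k ∘ₗ
    (ratLift k).toLinearMap
  map_one_eq_zero' := by simp
  leibniz' a b := by simp [fst_ratLift, mul_comm]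

theorem zDeriv_zvar (k : Type*) [Field k] (j : ℕ) :
    zDeriv k (zvar k j) = (∏ i ∈ Finset.range j, zvar k i)⁻¹ := by
  change (ratLift k (zvar k j)).snd = _
  rw [zvar, ratLift_algebraMap]
  simp [polyLift]

/-- The map `f ↦ t^{-ρ} (x∂)(t^ρ f)` on Laurent series:
it sends `∑ f_n x^n` to `∑ ((x∂) f_n + (n + ρ) f_n) x^n`. -/
def theta (k : Type*) [Field k] (ρ : k) :
    LaurentSeries (ZField k) →ₗ[k] LaurentSeries (ZField k) where
  toFun f :=
    { coeff := fun n => zDeriv k (f.coeff n) + algebraMap k (ZField k) (n + ρ) * f.coeff n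
      isPWO_support' := f.isPWO_support.mono fun n hn h => hn (by simp [h]) }
  map_add' f g := by
    ext n
    simp only [HahnSeries.coeff_add, map_add]
    ring
  map_smul' c f := by
    ext n
    simp only [HahnSeries.coeff_smul, Derivation.map_smul, RingHom.id_apply, smul_add,
      mul_smul_comm]

theorem coeff_theta (k : Type*) [Field k] (ρ : k) (f : LaurentSeries (ZField k)) (n : ℤ) :
    (theta k ρ f).coeff n =
      zDeriv k (f.coeff n) + algebraMap k (ZField k) (n + ρ) * f.coeff n := rfl

theorem theta_mul (k : Type*) [Field k] (ρ σ : k) (f g : LaurentSeries (ZField k)) :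
    theta k (ρ + σ) (f * g) = f * theta k σ g + g * theta k ρ f := by
  ext n
  rw [mul_comm g, coeff_theta, HahnSeries.coeff_add, HahnSeries.coeff_mul,
    HahnSeries.coeff_mul_left' f.isPWO_support (x := theta k ρ f) (fun n hn h => hn (by
      simp [coeff_theta, h])),
    HahnSeries.coeff_mul_right' g.isPWO_support (y := theta k σ g) (fun n hn h => hn (by
      simp [coeff_theta, h])),
    map_sum, Finset.mul_sum, ← Finset.sum_add_distrib, ← Finset.sum_add_distrib]
  refine Finset.sum_congr rfl fun ij hij => ?_
  have h : ij.1 + ij.2 = n := (Finset.mem_antidiagonal.mp hij).2.2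
  rw [← h, coeff_theta, coeff_theta, Derivation.leibniz]
  simp only [smul_eq_mul, map_add, Int.cast_add]
  ring

/-- The map `f ↦ t^{-ρ} ∂(t^ρ f) = x⁻¹ theta_ρ(f)` on Laurent series. -/
def laurentDel (k : Type*) [Field k] (ρ : k) :
    LaurentSeries (ZField k) →ₗ[k] LaurentSeries (ZField k) :=
  LinearMap.mulLeft k (HahnSeries.single (-1 : ℤ) (1 : ZField k)) ∘ₗ theta k ρ

theorem coeff_laurentDel (k : Type*) [Field k] (ρ : k) (f : LaurentSeries (ZField k)) (n : ℤ) :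
    (laurentDel k ρ f).coeff n = zDeriv k (f.coeff (n + 1)) +
      algebraMap k (ZField k) ((n + 1 : ℤ) + ρ) * f.coeff (n + 1) := by
  have h := HahnSeries.coeff_single_mul_add (r := (1 : ZField k)) (x := theta k ρ f)
    (a := n + 1) (b := (-1 : ℤ))
  rw [add_neg_cancel_right, one_mul, coeff_theta] at h
  exact h

/-- The underlying linear map of the derivation `∂` of `R`. -/
def delLin (k : Type*) [Field k] : Closure k →ₗ[k] Closure k :=
  (Finsupp.lsum k fun ρ : k => AddMonoidAlgebra.lsingle (R := k) ρ ∘ₗ laurentDel k ρ) ∘ₗ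
    (AddMonoidAlgebra.coeffLinearEquiv k : Closure k ≃ₗ[k] _).toLinearMap

theorem delLin_single (k : Type*) [Field k] (ρ : k) (f : LaurentSeries (ZField k)) :
    delLin k (AddMonoidAlgebra.single ρ f) = AddMonoidAlgebra.single ρ (laurentDel k ρ f) := by
  simp [delLin]

/-- The derivation `∂` of `R`: it is determined by
`∂(t^ρ ∑ f_n x^n) = t^ρ ∑ ((x∂) f_n + (n + ρ) f_n) x^{n-1}`. -/
def del (k : Type*) [Field k] : Derivation k (Closure k) (Closure k) :=
  Derivation.mk' (delLin k) (by
    intro a b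
    induction a using AddMonoidAlgebra.induction_linear with
    | zero => simp
    | add a a' ha ha' => simp only [add_mul, map_add, ha, ha', smul_eq_mul, mul_add]; ring
    | single ρ f =>
      induction b using AddMonoidAlgebra.induction_linear with
      | zero => simp
      | add b b' hb hb' =>
        simp only [mul_add, map_add, hb, hb', smul_eq_mul, add_mul]; ring
      | single σ g =>
        simp only [smul_eq_mul, delLin_single, AddMonoidAlgebra.single_mul_single]
        rw [add_comm σ ρ, ← AddMonoidAlgebra.single_add]
        congr 1
        simp only [laurentDel, LinearMap.comp_apply, LinearMap.mulLeft_apply, theta_mul]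
        ring)

theorem del_single (k : Type*) [Field k] (ρ : k) (f : LaurentSeries (ZField k)) :
    del k (AddMonoidAlgebra.single ρ f) = AddMonoidAlgebra.single ρ (laurentDel k ρ f) :=
  delLin_single k ρ f

/-- `∂ t^ρ = ρ t^ρ x⁻¹`. -/
theorem del_tpow (k : Type*) [Field k] (ρ : k) :
    del k (AddMonoidAlgebra.single ρ 1) =
      ρ • AddMonoidAlgebra.single ρ (HahnSeries.single (-1 : ℤ) 1) := by
  rw [del_single, AddMonoidAlgebra.smul_single]
  congr 1
  ext n
  rw [coeff_laurentDel, HahnSeries.coeff_smul, HahnSeries.coeff_one, HahnSeries.coeff_single]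
  by_cases h : n = -1
  · subst h; simp [Algebra.smul_def]
  · have h' : n + 1 ≠ 0 := by omega
    simp [h, h']

/-- The variable `x` of `R`. -/
def xvar (k : Type*) [Field k] : Closure k :=
  AddMonoidAlgebra.single 0 (HahnSeries.single 1 1)

theorem del_xvar (k : Type*) [Field k] : del k (xvar k) = 1 := by
  rw [xvar, del_single, AddMonoidAlgebra.one_def]
  congr 1
  ext n
  rw [coeff_laurentDel, HahnSeries.coeff_one, HahnSeries.coeff_single]
  by_cases h : n = 0
  · subst h; simp
  · have h' : n + 1 ≠ 1 := by omega
    simp [h, h']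

/-- `∂ z_{j+1} = x⁻¹ / (z₁ ⋯ z_j)`. -/
theorem del_zvar (k : Type*) [Field k] (j : ℕ) :
    del k (AddMonoidAlgebra.single 0 (HahnSeries.single 0 (zvar k j))) =
      AddMonoidAlgebra.single 0
        (HahnSeries.single (-1 : ℤ) (∏ i ∈ Finset.range j, zvar k i)⁻¹) := by
  rw [del_single]
  congr 1
  ext n
  rw [coeff_laurentDel, HahnSeries.coeff_single, HahnSeries.coeff_single]
  by_cases h : n = -1
  · subst h; simp [zDeriv_zvar]
  · have h' : n + 1 ≠ 0 := by omega
    simp [h, h']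

/-- The `x`-adic topology on `R`: a neighbourhood of `f` contains all `g` that agree with `f`
in the coefficients of `x^n` for all `n < N`, for some `N`. On a subspace of series without
negative powers of `x` it is the topology of the metric `2^{-ord_x (f - g)}`. -/
instance instTopologicalSpaceClosure (k : Type*) [Field k] : TopologicalSpace (Closure k) where
  IsOpen U := ∀ f ∈ U, ∃ N : ℤ, ∀ g : Closure k,
    (∀ σ : k, ∀ n < N, (g.coeff σ).coeff n = (f.coeff σ).coeff n) → g ∈ U
  isOpen_univ := fun _ _ => ⟨0, fun _ _ => trivial⟩
  isOpen_inter U V hU hV := fun f hf => by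
    obtain ⟨N, hN⟩ := hU f hf.1
    obtain ⟨M, hM⟩ := hV f hf.2
    exact ⟨max N M, fun g hg => ⟨hN g fun σ n hn => hg σ n (lt_max_of_lt_left hn),
      hM g fun σ n hn => hg σ n (lt_max_of_lt_right hn)⟩⟩
  isOpen_sUnion 𝒰 h𝒰 := fun f ⟨U, hU, hf⟩ => by
    obtain ⟨N, hN⟩ := h𝒰 U hU f hf
    exact ⟨N, fun g hg => ⟨U, hU, hN g hg⟩⟩

/-- A differential operator `L = ∑_j p_j ∂^j` in `k[[x]][∂]`, given by its finitely many non-zero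
coefficients `p_j = L j = ∑_i c_{ij} x^i`. -/
abbrev DiffOp (k : Type*) [Field k] : Type _ := ℕ →₀ PowerSeries k

/-- A power series in `k[[x]]` as an element of `R`. -/
def ofSeries (k : Type*) [Field k] (q : PowerSeries k) : Closure k :=
  AddMonoidAlgebra.single 0
    (HahnSeries.ofPowerSeries ℤ (ZField k) (q.map (algebraMap k (ZField k))))

/-- The action of `L = ∑_j p_j ∂^j` on `R`. -/
def act {k : Type*} [Field k] (L : DiffOp k) : Closure k →ₗ[k] Closure k :=
  L.sum fun j q =>
    LinearMap.mulLeft k (ofSeries k q) ∘ₗ ((del k : Closure k →ₗ[k] Closure k) ^ j)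

/-- `τ` is the shift of `L`: the least `i - j` with `c_{ij} ≠ 0`. In particular `L ≠ 0`. -/
def HasShift {k : Type*} [Field k] (L : DiffOp k) (τ : ℤ) : Prop :=
  IsLeast {m : ℤ | ∃ i j : ℕ, PowerSeries.coeff i (L j) ≠ 0 ∧ (i : ℤ) - j = m} τ

/-- The homogeneous part `∑_{i - j = τ} c_{ij} x^i ∂^j` of `L`. If `τ` is the shift of `L`, this
is the initial form of `L`. -/
def eulerPart {k : Type*} [Field k] (L : DiffOp k) (τ : ℤ) : DiffOp k :=
  Finsupp.onFinset L.support
    (fun j => PowerSeries.mk fun i =>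
      if (i : ℤ) - j = τ then PowerSeries.coeff i (L j) else 0)
    (fun j hj => by
      rw [Finsupp.mem_support_iff]
      intro h
      exact hj (by ext i; simp [h]))

/-- The indicial polynomial `χ_L(s) = ∑_j c_{jj} s (s - 1) ⋯ (s - j + 1)` of an operator of
shift `0`. Its roots are the local exponents. -/
def indicial {k : Type*} [Field k] (L : DiffOp k) : Polynomial k :=
  L.sum fun j q => Polynomial.C (PowerSeries.coeff j q) * descPochhammer k j

/-- The multiplicity `m_σ` of `σ` as a local exponent (`0` if `σ` is not a local exponent). -/
def mult {k : Type*} [Field k] (L : DiffOp k) (σ : k) : ℕ :=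
  (indicial L).rootMultiplicity σ

/-- `ξ(n) = m_ρ + m_{ρ+1} + ⋯ + m_{ρ+n}`. -/
def xi {k : Type*} [Field k] (L : DiffOp k) (ρ : k) (n : ℕ) : ℕ :=
  ∑ i ∈ Finset.range (n + 1), mult L (ρ + i)

/-- The set `A_n` of multi-indices `α` with `α₁ < ξ(n)` and `α_{j+1} ≤ α_j / p` for all `j ≥ 1`. -/
def expSet {k : Type*} [Field k] (p : ℕ) (L : DiffOp k) (ρ : k) (n : ℕ) : Set (ℕ →₀ ℕ) :=
  {α | α 0 < xi L ρ n ∧ ∀ j, p * α (j + 1) ≤ α j}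

/-- `e(α) = ᾱ₁ + p ᾱ₂ + p² ᾱ₃ + ⋯`, where `ᾱ_i` is the residue of `α_i` modulo `p`. -/
def weight (p : ℕ) (α : ℕ →₀ ℕ) : ℕ :=
  α.sum fun i a => p ^ i * (a % p)

/-- The space `t^ρ ∑_n (⨁_{α ∈ B n} k z^α) x^n` of formal series. -/
def monomialSpace {k : Type*} [Field k] (ρ : k) (B : ℤ → Set (ℕ →₀ ℕ)) :
    Submodule k (Closure k) where
  carrier := {f | (∀ σ, σ ≠ ρ → f.coeff σ = 0) ∧
    ∀ n : ℤ, (f.coeff ρ).coeff n ∈ Submodule.span k (zmon k '' B n)}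
  zero_mem' := ⟨fun _ _ => rfl, fun _ => Submodule.zero_mem _⟩
  add_mem' hf hg := ⟨fun σ hσ => by simp [hf.1 σ hσ, hg.1 σ hσ],
    fun n => Submodule.add_mem _ (hf.2 n) (hg.2 n)⟩
  smul_mem' c _ hf := ⟨fun σ hσ => by simp [hf.1 σ hσ],
    fun n => Submodule.smul_mem _ c (hf.2 n)⟩

/-- The `ρ`-function space `F = t^ρ ∑_{n ≥ 0} ⨁_{α ∈ A_n} k z^α x^n` associated to `L`. -/
def rhoSpace {k : Type*} [Field k] (p : ℕ) (L : DiffOp k) (ρ : k) : Submodule k (Closure k) :=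
  monomialSpace ρ fun n => {α | ∃ m : ℕ, n = m ∧ α ∈ expSet p L ρ m}

/-- The subspace `F x` of `F`. -/
def rhoSpaceX {k : Type*} [Field k] (p : ℕ) (L : DiffOp k) (ρ : k) : Submodule k (Closure k) :=
  (rhoSpace p L ρ).map (LinearMap.mulLeft k (xvar k))

/-- The subspace `H` of `F` topologically spanned by the monomials `t^ρ x^n z^α` with `n ≥ 0`,
`α ∈ A_n` and `e(α) ≥ m_{ρ+n}`. -/
def complSpace {k : Type*} [Field k] (p : ℕ) (L : DiffOp k) (ρ : k) : Submodule k (Closure k) :=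
  monomialSpace ρ fun n =>
    {α | ∃ m : ℕ, n = m ∧ α ∈ expSet p L ρ m ∧ mult L (ρ + m) ≤ weight p α}

/-- `φ : M → R`, defined on a `k`-subspace `M` of `R`, is linear over the ring of constants
`C = {c ∈ R : ∂ c = 0}`: it respects every `C`-linear relation that holds between elements of `M`.
(`M` need not be stable under multiplication by `C`.) -/
def IsConstLinear {k : Type*} [Field k] {M : Submodule k (Closure k)} (φ : M → Closure k) : Prop :=
  ∀ (n : ℕ) (c : Fin n → Closure k) (f : Fin n → M) (g : M), (∀ i, del k (c i) = 0) →
    (g : Closure k) = ∑ i, c i * (f i : Closure k) → φ g = ∑ i, c i * φ (f i)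

end EulerClosure

end

open EulerClosure

/-!
The operator `θ = x∂` acts on `t^σ z^α x^n` through the derivation `D = zDeriv k` of `k(z)`:
it sends it to `t^σ x^n (D + n + σ) z^α`. Hence the initial form acts on the coefficient of
`t^σ x^n` as `χ(D + n + σ)` (`coef_act_eulerPart`), which is `D ^ m`, with `m` the multiplicity of
the local exponent `n + σ`, times a power series in `D` with non-zero constant term. As `D` is
locally nilpotent on all of `k(z)` (`exists_zEnd_pow_eq_zero`), the second factor is invertible, and
everything reduces to the powers of `D`.

The weight `e(α)` reads the residues of the exponents as the `p`-adic digits of an integer. The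
derivative of an admissible monomial `z^α` is a combination of the monomials obtained by lowering
the first `j` exponents by `1`, where the `j`-th digit is not zero. The smallest such `j` is
subtraction of `1` with borrow, so it lowers the weight by one, and all others lower it more
(`zDeriv_zmon_eq_add`). Therefore `D ^ m` kills the monomials of weight less than `m`, and it maps
those of weight at least `m` with `α₁ < N + m` triangularly onto those with `α₁ < N`: this is the
bijection between the complement and `F x`.

For linearity over the constants, the complement is enlarged to a module over the constants on which
the initial form is still injective. Constants of `R` have coefficients in `ker D`, and only at
`t^σ x^n` with `n + σ = 0` in `k` (`coef_of_del_eq_zero`), so multiplication by them preserves the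
condition that the coefficient of `t^σ x^n` lies in the `ker D`-span of monomials of weight at least
`m_{n + σ}`. On this span `D ^ m` is injective, since two monomials of the same weight differ by a
`p`-th power and hence by a constant factor (`eq_zero_of_mem_constSpan`).

Finally `L₀ - L` raises the order in `x`, so `S ∘ T` does too, and the geometric series
gives the inverse of `Id - S ∘ T` (`exists_equiv_sub_of_submodule`).
-/

noncomputable section

namespace EulerClosure

/-! ### Combinatorics of the weight -/

/-- The indicator of the interval `[a, j]`, as a multi-index. -/
def block (a j : ℕ) : ℕ →₀ ℕ :=
  Finsupp.onFinset (Finset.Icc a j) (fun i => if a ≤ i ∧ i ≤ j then 1 else 0) (by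
    intro i hi
    by_contra h
    exact hi (if_neg fun h' => h (Finset.mem_Icc.2 h')))

theorem block_apply (a j i : ℕ) : block a j i = if a ≤ i ∧ i ≤ j then 1 else 0 := rfl

theorem block_self (j : ℕ) : block j j = Finsupp.single j 1 := by
  ext i
  rw [block_apply, Finsupp.single_apply]
  exact if_congr (by omega) rfl rfl

theorem block_eq_succ_add {a j : ℕ} (h : a < j) :
    block a j = block (a + 1) j + Finsupp.single a 1 := by
  ext i
  rw [Finsupp.add_apply, block_apply, block_apply, Finsupp.single_apply]
  split_ifs <;> omega

theorem block_zero_split {i j : ℕ} (h : i < j) : block 0 j = block 0 i + block (i + 1) j := by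
  ext l
  rw [Finsupp.add_apply, block_apply, block_apply, block_apply]
  split_ifs <;> omega

theorem weight_eq_erase (p : ℕ) (α : ℕ →₀ ℕ) (a : ℕ) :
    weight p α = p ^ a * (α a % p) + weight p (α.erase a) :=
  (Finsupp.add_sum_erase' α a (fun i b => p ^ i * (b % p)) (by simp)).symm

theorem erase_sub_single (α : ℕ →₀ ℕ) (a : ℕ) :
    (α - Finsupp.single a 1).erase a = α.erase a := by
  ext i
  by_cases h : i = a
  · subst h; simp
  · simp [Finsupp.erase_ne h, Ne.symm h]

theorem weight_sub_single_of_not_dvd {p : ℕ} {α : ℕ →₀ ℕ} {a : ℕ} (h : ¬ p ∣ α a) :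
    weight p (α - Finsupp.single a 1) + p ^ a = weight p α := by
  rw [weight_eq_erase p α a, weight_eq_erase p (α - _) a, erase_sub_single, Finsupp.tsub_apply,
    Finsupp.single_eq_same]
  have h1 : α a % p = (α a - 1) % p + 1 := by
    have h0 : α a % p ≠ 0 := fun h' => h (Nat.dvd_of_mod_eq_zero h')
    have h2 := Nat.div_add_mod (α a) p
    rcases Nat.eq_zero_or_pos p with rfl | hp
    · simp at h0 ⊢; omega
    have h3 := Nat.mod_lt (α a) hp
    have : α a - 1 = (α a % p - 1) + p * (α a / p) := by omega
    rw [this, Nat.add_mul_mod_self_left,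
      Nat.mod_eq_of_lt (show α a % p - 1 < p by omega)]
    omega
  rw [h1]; ring

theorem weight_sub_single_of_dvd {p : ℕ} (hp : 0 < p) {α : ℕ →₀ ℕ} {a : ℕ} (h : p ∣ α a)
    (h1 : 1 ≤ α a) :
    weight p (α - Finsupp.single a 1) + p ^ a = weight p α + p ^ (a + 1) := by
  rw [weight_eq_erase p α a, weight_eq_erase p (α - _) a, erase_sub_single, Finsupp.tsub_apply,
    Finsupp.single_eq_same, Nat.mod_eq_zero_of_dvd h]
  obtain ⟨c, hc⟩ := h
  have h2 : (α a - 1) % p = p - 1 := by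
    obtain ⟨c, rfl⟩ : ∃ d, c = d + 1 := ⟨c - 1, by
      rcases c with _ | c
      · simp at hc; omega
      · rfl⟩
    rw [hc, mul_add, mul_one, show p * c + p - 1 = (p - 1) + p * c by omega,
      Nat.add_mul_mod_self_left, Nat.mod_eq_of_lt (by omega)]
  rw [h2]
  obtain ⟨q, rfl⟩ : ∃ q, p = q + 1 := ⟨p - 1, by omega⟩
  simp only [Nat.add_sub_cancel]; ring

theorem weight_sub_single_le {p : ℕ} (hp : 0 < p) {α : ℕ →₀ ℕ} {a : ℕ} (h1 : 1 ≤ α a) :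
    weight p (α - Finsupp.single a 1) + p ^ a ≤ weight p α + p ^ (a + 1) := by
  by_cases h : p ∣ α a
  · exact (weight_sub_single_of_dvd hp h h1).le
  · rw [weight_sub_single_of_not_dvd h]; omega

/-- Subtracting `1` from the digits in `[a, j]` lowers the weight by at least `p ^ a`,
provided that the last of these digits is not zero: the carries are absorbed by it. -/
theorem weight_sub_block_le {p : ℕ} (hp : 0 < p) {α : ℕ →₀ ℕ} {a j : ℕ} (haj : a ≤ j)
    (h1 : ∀ i, a ≤ i → i ≤ j → 1 ≤ α i) (hj : ¬ p ∣ α j) :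
    weight p (α - block a j) + p ^ a ≤ weight p α := by
  induction haj using Nat.decreasingInduction with
  | self => rw [block_self, weight_sub_single_of_not_dvd hj]
  | of_succ b hb ih =>
    have ih := ih fun i hi => h1 i (by omega)
    have hb' : (α - block (b + 1) j) b = α b := by
      rw [Finsupp.tsub_apply, block_apply, if_neg (by omega), Nat.sub_zero]
    have := weight_sub_single_le hp (α := α - block (b + 1) j) (a := b)
      (by rw [hb']; exact h1 b le_rfl (by omega))
    rw [block_eq_succ_add hb, tsub_add_eq_tsub_tsub]
    omega

/-- If the digits in `[a, j)` vanish, subtracting `1` from the digits in `[a, j]` is subtraction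
with borrow, and lowers the weight by exactly `p ^ a`. -/
theorem weight_sub_block_eq {p : ℕ} (hp : 0 < p) {α : ℕ →₀ ℕ} {a j : ℕ} (haj : a ≤ j)
    (h1 : ∀ i ≤ j, 1 ≤ α i) (hj : ¬ p ∣ α j) (hd : ∀ i < j, p ∣ α i) :
    weight p (α - block a j) + p ^ a = weight p α := by
  induction haj using Nat.decreasingInduction with
  | self => rw [block_self, weight_sub_single_of_not_dvd hj]
  | of_succ b hb ih =>
    have hb' : (α - block (b + 1) j) b = α b := by
      rw [Finsupp.tsub_apply, block_apply, if_neg (by omega), Nat.sub_zero]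
    have := weight_sub_single_of_dvd hp (α := α - block (b + 1) j) (a := b)
      (by rw [hb']; exact hd b hb) (by rw [hb']; exact h1 b (by omega))
    rw [block_eq_succ_add hb, tsub_add_eq_tsub_tsub]
    omega

/-- The multi-indices with `α_{j+1} ≤ α_j / p` for all `j`, the quotient being that of rational
numbers. They decrease as long as they do not vanish, so that a monomial with such an exponent can
be divided by `z₁ ⋯ z_j` whenever `p` does not divide `α_j`. -/
def admissible (p : ℕ) : Set (ℕ →₀ ℕ) := {α | ∀ j, p * α (j + 1) ≤ α j}

theorem one_le_of_admissible {p : ℕ} (hp : 0 < p) {α : ℕ →₀ ℕ} (hα : α ∈ admissible p) {j : ℕ}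
    (hj : ¬ p ∣ α j) : ∀ i ≤ j, 1 ≤ α i := by
  intro i hi
  induction hi using Nat.decreasingInduction with
  | self =>
    by_contra h
    exact hj ((show α j = 0 by omega) ▸ dvd_zero p)
  | of_succ i hi ih => exact (Nat.mul_pos hp ih).trans_le (hα i)

theorem admissible_sub_block {p : ℕ} (hp : 0 < p) {α : ℕ →₀ ℕ} (hα : α ∈ admissible p) {j : ℕ}
    (hj : ¬ p ∣ α j) : α - block 0 j ∈ admissible p := by
  intro i
  have h := hα i
  have h1 := one_le_of_admissible hp hα hj
  simp only [Finsupp.tsub_apply, block_apply, Nat.zero_le, true_and]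
  rcases lt_trichotomy i j with hij | rfl | hij
  · rw [if_pos (by omega), if_pos (by omega), Nat.mul_sub]
    omega
  · rw [if_neg (by omega), if_pos le_rfl, Nat.sub_zero]
    have : p * α (i + 1) ≠ α i := fun h' => hj (h' ▸ dvd_mul_right _ _)
    omega
  · rw [if_neg (by omega), if_neg (by omega)]
    exact h

theorem sub_block_add_block {p : ℕ} (hp : 0 < p) {α : ℕ →₀ ℕ} (hα : α ∈ admissible p) {j : ℕ}
    (hj : ¬ p ∣ α j) : α - block 0 j + block 0 j = α := by
  have h1 := one_le_of_admissible hp hα hj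
  ext i
  simp only [Finsupp.add_apply, Finsupp.tsub_apply, block_apply, Nat.zero_le, true_and]
  split_ifs with h
  · have := h1 i h; omega
  · omega

/-- Addition of `1` with carry to the digits of an admissible multi-index stays within the
admissible multi-indices. -/
theorem exists_add_block {p : ℕ} (hp : p.Prime) {β : ℕ →₀ ℕ} (hβ : β ∈ admissible p) :
    ∃ j, β + block 0 j ∈ admissible p ∧ ¬ p ∣ (β + block 0 j) j ∧
      ∀ i < j, p ∣ (β + block 0 j) i := by
  have hex : ∃ j, ¬ p ∣ β j + 1 := by
    obtain ⟨N, hN⟩ := β.support.exists_notMem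
    refine ⟨N, ?_⟩
    rw [Finsupp.notMem_support_iff.1 hN, zero_add, Nat.dvd_one]
    exact hp.one_lt.ne'
  classical
  set j := Nat.find hex with hjdef
  have hj : ¬ p ∣ β j + 1 := Nat.find_spec hex
  have hlt : ∀ i < j, p ∣ β i + 1 := fun i hi => not_not.1 (Nat.find_min hex hi)
  refine ⟨j, fun i => ?_, ?_, fun i hi => ?_⟩
  · have h := hβ i
    simp only [Finsupp.add_apply, block_apply, Nat.zero_le, true_and]
    rcases lt_or_ge i j with hij | hij
    · rw [if_pos (by omega), if_pos (by omega)]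
      obtain ⟨c, hc⟩ := hlt i hij
      rw [hc]
      refine Nat.mul_le_mul_left p ?_
      have : p * β (i + 1) < p * c := by omega
      exact Nat.lt_of_mul_lt_mul_left this
    · rw [if_neg (by omega), add_zero]
      exact h.trans (Nat.le_add_right _ _)
  · simpa [block_apply] using hj
  · simpa [block_apply, hi.le] using hlt i hi

/-! ### The derivation of `k(z)` on monomials -/

section Monomials

variable {k : Type*} [Field k]

theorem zmon_zero : zmon k 0 = 1 := by
  rw [zmon, show MvPolynomial.monomial (0 : ℕ →₀ ℕ) (1 : k) = 1 from rfl, map_one]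

theorem zmon_add (α β : ℕ →₀ ℕ) : zmon k (α + β) = zmon k α * zmon k β := by
  rw [zmon, zmon, zmon, ← map_mul, MvPolynomial.monomial_mul, one_mul]

theorem zmon_single (j n : ℕ) : zmon k (Finsupp.single j n) = zvar k j ^ n := by
  rw [zmon, zvar, ← map_pow, MvPolynomial.X_pow_eq_monomial]

theorem zmon_ne_zero (α : ℕ →₀ ℕ) : zmon k α ≠ 0 := by
  rw [zmon, Ne, map_eq_zero_iff _ (IsFractionRing.injective (MvPolynomial ℕ k) (ZField k)),
    MvPolynomial.monomial_eq_zero]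
  exact one_ne_zero

theorem zvar_ne_zero (j : ℕ) : zvar k j ≠ 0 := by
  have := zmon_ne_zero (k := k) (Finsupp.single j 1)
  rwa [zmon_single, pow_one] at this

theorem zmon_block_zero (j : ℕ) : zmon k (block 0 j) = ∏ i ∈ Finset.range (j + 1), zvar k i := by
  induction j with
  | zero => rw [block_self, zmon_single, pow_one, Finset.prod_range_one]
  | succ j ih =>
    rw [block_zero_split (Nat.lt_succ_self j), zmon_add, ih, block_self, zmon_single, pow_one,
      Finset.prod_range_succ _ (j + 1)]

/-- The logarithmic derivative of a monomial is additive in the exponent. -/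
theorem zDeriv_zmon (α : ℕ →₀ ℕ) :
    zDeriv k (zmon k α) = zmon k α * α.sum fun j a => (a : ZField k) * (zmon k (block 0 j))⁻¹ := by
  induction α using Finsupp.induction_linear with
  | zero => simp [zmon_zero]
  | add α β hα hβ =>
    rw [zmon_add, Derivation.leibniz, hα, hβ, Finsupp.sum_add_index' (by simp)
      (fun i b c => by push_cast; ring)]
    simp only [smul_eq_mul]; ring
  | single j n =>
    rw [Finsupp.sum_single_index (by simp), zmon_single, Derivation.leibniz_pow, zDeriv_zvar,
      zmon_block_zero, Finset.prod_range_succ, mul_inv]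
    rcases n with _ | n
    · simp
    · simp only [Nat.add_sub_cancel, smul_eq_mul, nsmul_eq_mul, pow_succ]
      field_simp [zvar_ne_zero (k := k) j]

variable {p : ℕ} [hp : Fact p.Prime] [CharP k p]

theorem zDeriv_zmon_of_admissible {α : ℕ →₀ ℕ} (hα : α ∈ admissible p) :
    zDeriv k (zmon k α) =
      ∑ j ∈ α.support with ¬ p ∣ α j, (α j : k) • zmon k (α - block 0 j) := by
  rw [zDeriv_zmon, Finsupp.sum, Finset.mul_sum, Finset.sum_filter]
  refine Finset.sum_congr rfl fun j _ => ?_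
  have hc : ((α j : ℕ) : ZField k) = algebraMap k (ZField k) (α j : k) := (map_natCast _ _).symm
  by_cases h : ¬ p ∣ α j
  · rw [if_pos h]
    conv_lhs => rw [← sub_block_add_block hp.out.pos hα h, zmon_add]
    rw [sub_block_add_block hp.out.pos hα h, Algebra.smul_def, hc]
    field_simp [zmon_ne_zero (k := k) (block 0 j)]
  · rw [if_neg h, hc, (CharP.cast_eq_zero_iff k p _).2 (not_not.1 h)]
    simp

omit hp in
theorem zDeriv_zmon_of_dvd {α : ℕ →₀ ℕ} (h : ∀ j, p ∣ α j) : zDeriv k (zmon k α) = 0 := by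
  rw [zDeriv_zmon, Finsupp.sum, Finset.sum_eq_zero, mul_zero]
  intro j _
  have hc : ((α j : ℕ) : ZField k) = algebraMap k (ZField k) (α j : k) := (map_natCast _ _).symm
  rw [hc, (CharP.cast_eq_zero_iff k p _).2 (h j), map_zero, zero_mul]

/-- The derivation `x∂` of `k(z)` as a `k`-linear endomorphism. -/
abbrev zEnd (k : Type*) [Field k] : Module.End k (ZField k) := (zDeriv k : ZField k →ₗ[k] ZField k)

variable (p) in
theorem zEnd_pow_zmon_eq_zero {n : ℕ} : ∀ {α : ℕ →₀ ℕ}, α ∈ admissible p → weight p α < n →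
    (zEnd k ^ n) (zmon k α) = 0 := by
  induction n with
  | zero => intro α _ h; omega
  | succ n ih =>
    intro α hα h
    rw [pow_succ, Module.End.mul_apply]
    change (zEnd k ^ n) (zDeriv k _) = 0
    rw [zDeriv_zmon_of_admissible hα, map_sum]
    refine Finset.sum_eq_zero fun j hj => ?_
    have hj' := (Finset.mem_filter.1 hj).2
    have := weight_sub_block_le hp.out.pos (Nat.zero_le j)
      (fun i _ => one_le_of_admissible hp.out.pos hα hj' i) hj'
    rw [map_smul, ih (admissible_sub_block hp.out.pos hα hj') (by rw [pow_zero] at this; omega),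
      smul_zero]

/-- The leading term of the derivative of a monomial with respect to the weight: if `j` is the
place of the first non-zero digit, all other terms have smaller weight. -/
theorem zDeriv_zmon_eq_add {α : ℕ →₀ ℕ} (hα : α ∈ admissible p) {j : ℕ} (hj : ¬ p ∣ α j)
    (hd : ∀ i < j, p ∣ α i) :
    ∃ s : Finset ℕ, (∀ i ∈ s, ¬ p ∣ α i ∧ weight p (α - block 0 i) < weight p (α - block 0 j)) ∧
      zDeriv k (zmon k α) = (α j : k) • zmon k (α - block 0 j) +
        ∑ i ∈ s, (α i : k) • zmon k (α - block 0 i) := by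
  have hpos := hp.out.pos
  refine ⟨{i ∈ α.support | ¬ p ∣ α i}.erase j, fun i hi => ?_, ?_⟩
  · obtain ⟨hij, hi⟩ := Finset.mem_erase.1 hi
    have hi' := (Finset.mem_filter.1 hi).2
    refine ⟨hi', ?_⟩
    have hlt : j < i := by
      by_contra hlt
      exact hi' (hd i (by omega))
    have hval : ∀ l, j < l → (α - block 0 j) l = α l := fun l hl => by
      rw [Finsupp.tsub_apply, block_apply, if_neg (by omega), Nat.sub_zero]
    rw [block_zero_split hlt, tsub_add_eq_tsub_tsub]
    have h1 := weight_sub_block_le hpos (α := α - block 0 j) (Nat.succ_le_of_lt hlt)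
      (fun l hl hli => by
        rw [hval l hl]
        exact one_le_of_admissible hpos hα hi' l hli) (by rwa [hval i hlt])
    have h2 := Nat.pow_pos (n := j + 1) hpos
    exact (Nat.lt_add_of_pos_right h2).trans_le h1
  · rw [zDeriv_zmon_of_admissible hα, Finset.add_sum_erase _
      (fun i => (α i : k) • zmon k (α - block 0 i))]
    refine Finset.mem_filter.2 ⟨?_, hj⟩
    rw [Finsupp.mem_support_iff]
    intro h
    exact hj (h ▸ dvd_zero p)

/-- The first digit that does not vanish. -/
theorem exists_first_not_dvd {p : ℕ} {α : ℕ →₀ ℕ} (h : weight p α ≠ 0) :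
    ∃ j, ¬ p ∣ α j ∧ ∀ i < j, p ∣ α i := by
  have hex : ∃ j, ¬ p ∣ α j := by
    by_contra! hall
    refine h (Finset.sum_eq_zero fun i _ => ?_)
    change p ^ i * (α i % p) = 0
    rw [Nat.mod_eq_zero_of_dvd (hall i), mul_zero]
  classical
  exact ⟨Nat.find hex, Nat.find_spec hex, fun i hi => not_not.1 (Nat.find_min hex hi)⟩

theorem zEnd_pow_weight_zmon_ne_zero {n : ℕ} : ∀ {α : ℕ →₀ ℕ}, α ∈ admissible p →
    weight p α = n → (zEnd k ^ n) (zmon k α) ≠ 0 := by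
  induction n with
  | zero => intro α _ _; exact zmon_ne_zero α
  | succ n ih =>
    intro α hα h
    obtain ⟨j, hj, hd⟩ := exists_first_not_dvd (show weight p α ≠ 0 by omega)
    have hw := weight_sub_block_eq hp.out.pos (Nat.zero_le j)
      (one_le_of_admissible hp.out.pos hα hj) hj hd
    rw [pow_zero] at hw
    have hne := ih (admissible_sub_block hp.out.pos hα hj) (by omega)
    obtain ⟨s, hs, hD⟩ := zDeriv_zmon_eq_add (k := k) hα hj hd
    rw [pow_succ, Module.End.mul_apply]
    change (zEnd k ^ n) (zDeriv k _) ≠ 0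
    rw [hD, map_add, map_sum, Finset.sum_eq_zero, add_zero, map_smul]
    · exact smul_ne_zero (fun h' => hj ((CharP.cast_eq_zero_iff k p _).1 h')) hne
    · intro i hi
      rw [map_smul, zEnd_pow_zmon_eq_zero p
        (admissible_sub_block hp.out.pos hα (hs i hi).1) (by have := (hs i hi).2; omega), smul_zero]

variable (k p) in
/-- The span of the admissible monomials `z^α` whose first exponent is less than `N`; as the index
of the variables is shifted by one, this is the exponent `α 0`. -/
def admSpan (N : ℕ) : Submodule k (ZField k) :=
  Submodule.span k (zmon k '' {α | α ∈ admissible p ∧ α 0 < N})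

omit hp [CharP k p] in
theorem admSpan_mono {M N : ℕ} (h : M ≤ N) : admSpan k p M ≤ admSpan k p N :=
  Submodule.span_mono (Set.image_mono fun _ hα => ⟨hα.1, hα.2.trans_le h⟩)

omit hp [CharP k p] in
theorem admSpan_zero : admSpan k p 0 = ⊥ := by
  rw [admSpan, show {α : ℕ →₀ ℕ | α ∈ admissible p ∧ α 0 < 0} = ∅ by ext; simp]
  simp

theorem zEnd_mem_admSpan {N : ℕ} {f : ZField k} (hf : f ∈ admSpan k p (N + 1)) :
    zEnd k f ∈ admSpan k p N := by
  induction hf using Submodule.span_induction with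
  | zero => rw [map_zero]; exact zero_mem _
  | add f g _ _ hf hg => rw [map_add]; exact add_mem hf hg
  | smul c f _ hf => rw [map_smul]; exact Submodule.smul_mem _ _ hf
  | mem f hf =>
    obtain ⟨α, ⟨hα, hN⟩, rfl⟩ := hf
    change zDeriv k _ ∈ _
    rw [zDeriv_zmon_of_admissible hα]
    refine Submodule.sum_mem _ fun j hj => Submodule.smul_mem _ _ (Submodule.subset_span
      ⟨_, ⟨admissible_sub_block hp.out.pos hα (Finset.mem_filter.1 hj).2, ?_⟩, rfl⟩)
    have := one_le_of_admissible hp.out.pos hα (Finset.mem_filter.1 hj).2 0 (Nat.zero_le j)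
    simp only [Finsupp.tsub_apply, block_apply, Nat.zero_le, and_self, if_true]
    omega

theorem zEnd_pow_mem_admSpan {N : ℕ} (m : ℕ) {f : ZField k} (hf : f ∈ admSpan k p (N + m)) :
    (zEnd k ^ m) f ∈ admSpan k p N := by
  induction m generalizing f with
  | zero => exact hf
  | succ m ih =>
    rw [pow_succ, Module.End.mul_apply]
    exact ih (zEnd_mem_admSpan hf)

theorem zEnd_stable_admSpan {N : ℕ} {f : ZField k} (hf : f ∈ admSpan k p N) :
    zEnd k f ∈ admSpan k p N :=
  zEnd_mem_admSpan (admSpan_mono (Nat.le_succ N) hf)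

theorem zEnd_pow_eq_zero_of_mem_admSpan {N : ℕ} {f : ZField k} (hf : f ∈ admSpan k p N) :
    (zEnd k ^ N) f = 0 := by
  have := zEnd_pow_mem_admSpan (N := 0) N (by rwa [zero_add] : f ∈ admSpan k p (0 + N))
  rwa [admSpan_zero, Submodule.mem_bot] at this

/-- Every monomial `z^β` is the leading term of the derivative of a monomial, so that surjectivity
follows by induction on the weight. -/
theorem zmon_mem_map_zEnd {N : ℕ} (n : ℕ) : ∀ {β : ℕ →₀ ℕ}, β ∈ admissible p → β 0 < N →
    weight p β = n → zmon k β ∈ (admSpan k p (N + 1)).map (zEnd k) := by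
  induction n using Nat.strong_induction_on with
  | _ n ih =>
    intro β hβ hN hn
    obtain ⟨j, hα, hj, hd⟩ := exists_add_block hp.out hβ
    obtain ⟨s, hs, hD⟩ := zDeriv_zmon_eq_add (k := k) hα hj hd
    rw [add_tsub_cancel_right] at hs hD
    have h0 : (β + block 0 j) 0 < N + 1 := by
      rw [Finsupp.add_apply, block_apply, if_pos (by omega)]; omega
    have h1 : zDeriv k (zmon k (β + block 0 j)) ∈ (admSpan k p (N + 1)).map (zEnd k) :=
      ⟨_, Submodule.subset_span ⟨_, ⟨hα, h0⟩, rfl⟩, rfl⟩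
    have h2 : ∑ i ∈ s, (((β + block 0 j) i : ℕ) : k) • zmon k (β + block 0 j - block 0 i) ∈
        (admSpan k p (N + 1)).map (zEnd k) := by
      refine Submodule.sum_mem _ fun i hi => Submodule.smul_mem _ _
        (ih _ (hn ▸ (hs i hi).2) (admissible_sub_block hp.out.pos hα (hs i hi).1) ?_ rfl)
      have := one_le_of_admissible hp.out.pos hα (hs i hi).1 0 (Nat.zero_le i)
      rw [Finsupp.tsub_apply, block_apply, if_pos (by omega)]
      omega
    have h3 := Submodule.sub_mem _ h1 h2
    rw [hD, add_sub_cancel_right] at h3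
    exact (Submodule.smul_mem_iff _
      (fun h' => hj ((CharP.cast_eq_zero_iff k p _).1 h'))).1 h3

theorem exists_zEnd_pow_eq {N : ℕ} (m : ℕ) {f : ZField k} (hf : f ∈ admSpan k p N) :
    ∃ g ∈ admSpan k p (N + m), (zEnd k ^ m) g = f := by
  induction m with
  | zero => exact ⟨f, hf, rfl⟩
  | succ m ih =>
    obtain ⟨g, hg, rfl⟩ := ih
    have hle : admSpan k p (N + m) ≤ (admSpan k p (N + m + 1)).map (zEnd k) := by
      rw [admSpan, Submodule.span_le]
      rintro _ ⟨β, ⟨hβ, hN⟩, rfl⟩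
      exact zmon_mem_map_zEnd _ hβ hN rfl
    obtain ⟨h, hh, rfl⟩ := hle hg
    exact ⟨h, hh, by rw [pow_succ, Module.End.mul_apply]⟩

/-- Monomials of weight less than `m` are killed by `(x∂)^m`, and can be dropped from a
preimage. -/
theorem exists_weight_le_zEnd_pow_eq {N m : ℕ} {f : ZField k} (hf : f ∈ admSpan k p (N + m)) :
    ∃ g ∈ Submodule.span k (zmon k '' {α | (α ∈ admissible p ∧ α 0 < N + m) ∧ m ≤ weight p α}),
      (zEnd k ^ m) g = (zEnd k ^ m) f := by
  induction hf using Submodule.span_induction with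
  | zero => exact ⟨0, zero_mem _, rfl⟩
  | add f f' _ _ hf hf' =>
    obtain ⟨g, hg, h⟩ := hf
    obtain ⟨g', hg', h'⟩ := hf'
    exact ⟨g + g', add_mem hg hg', by rw [map_add, map_add, h, h']⟩
  | smul c f _ hf =>
    obtain ⟨g, hg, h⟩ := hf
    exact ⟨c • g, Submodule.smul_mem _ _ hg, by rw [map_smul, map_smul, h]⟩
  | mem f hf =>
    obtain ⟨α, hα, rfl⟩ := hf
    rcases lt_or_ge (weight p α) m with h | h
    · exact ⟨0, zero_mem _, by rw [map_zero, zEnd_pow_zmon_eq_zero p hα.1 h]⟩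
    · exact ⟨_, Submodule.subset_span ⟨α, ⟨hα, h⟩, rfl⟩, rfl⟩

end Monomials

/-! ### Constants of `k(z)` -/

section Constants

/-- The constants of `k(z)` with respect to the derivation `x∂`. -/
def zConst (k : Type*) [Field k] : Subring (ZField k) where
  carrier := {c | zDeriv k c = 0}
  mul_mem' {a b} ha hb := by
    change zDeriv k (a * b) = 0
    rw [Derivation.leibniz, show zDeriv k a = 0 from ha, show zDeriv k b = 0 from hb]
    simp
  one_mem' := (zDeriv k).map_one_eq_zero
  add_mem' {a b} ha hb := by
    change zDeriv k (a + b) = 0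
    rw [map_add, show zDeriv k a = 0 from ha, show zDeriv k b = 0 from hb, add_zero]
  zero_mem' := map_zero _
  neg_mem' {a} ha := by
    change zDeriv k (-a) = 0
    rw [map_neg, show zDeriv k a = 0 from ha, neg_zero]

variable {k : Type*} [Field k]

theorem mem_zConst {c : ZField k} : c ∈ zConst k ↔ zDeriv k c = 0 := Iff.rfl

theorem algebraMap_mem_zConst (a : k) : algebraMap k (ZField k) a ∈ zConst k :=
  (zDeriv k).map_algebraMap a

theorem inv_mem_zConst {c : ZField k} (hc : c ∈ zConst k) : c⁻¹ ∈ zConst k := by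
  rw [mem_zConst, Derivation.leibniz_inv, mem_zConst.1 hc, smul_zero]

theorem zEnd_mul_of_mem_zConst {c : ZField k} (hc : c ∈ zConst k) (f : ZField k) :
    zEnd k (c * f) = c * zEnd k f := by
  change zDeriv k _ = c * zDeriv k f
  rw [Derivation.leibniz, mem_zConst.1 hc, smul_zero, add_zero, smul_eq_mul]

theorem zEnd_pow_mul_of_mem_zConst {c : ZField k} (hc : c ∈ zConst k) (n : ℕ) (f : ZField k) :
    (zEnd k ^ n) (c * f) = c * (zEnd k ^ n) f := by
  induction n generalizing f with
  | zero => rfl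
  | succ n ih =>
    rw [pow_succ, Module.End.mul_apply, Module.End.mul_apply, zEnd_mul_of_mem_zConst hc, ih]

theorem zEnd_pow_eq_zero_mono {m n : ℕ} (h : m ≤ n) {f : ZField k} (hf : (zEnd k ^ m) f = 0) :
    (zEnd k ^ n) f = 0 := by
  rw [← Nat.sub_add_cancel h, pow_add, Module.End.mul_apply, hf, map_zero]

/-- Products of elements killed by powers of a derivation are killed by a power. -/
theorem zEnd_pow_mul_eq_zero : ∀ (N m n : ℕ) (f g : ZField k), m + n ≤ N →
    (zEnd k ^ m) f = 0 → (zEnd k ^ n) g = 0 → (zEnd k ^ N) (f * g) = 0 := by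
  intro N
  induction N with
  | zero =>
    intro m n f g h hf _
    obtain rfl : m = 0 := by omega
    rw [pow_zero, Module.End.one_apply] at hf ⊢
    rw [hf, zero_mul]
  | succ N ih =>
    intro m n f g h hf hg
    rcases m with _ | m
    · rw [pow_zero, Module.End.one_apply] at hf
      rw [hf, zero_mul, map_zero]
    rcases n with _ | n
    · rw [pow_zero, Module.End.one_apply] at hg
      rw [hg, mul_zero, map_zero]
    have hD : zEnd k (f * g) = f * zEnd k g + g * zEnd k f := (zDeriv k).leibniz f g
    rw [pow_succ, Module.End.mul_apply, hD, map_add,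
      ih (m + 1) n f _ (by omega) hf (by rwa [pow_succ, Module.End.mul_apply] at hg),
      ih (n + 1) m g _ (by omega) hg (by rwa [pow_succ, Module.End.mul_apply] at hf), add_zero]

variable {p : ℕ} [hp : Fact p.Prime] [CharP k p]

omit hp in
variable (p) in
theorem pow_mem_zConst (f : ZField k) : f ^ p ∈ zConst k := by
  have hc : (p : ZField k) = 0 := by
    rw [← map_natCast (algebraMap k (ZField k)), CharP.cast_eq_zero, map_zero]
  rw [mem_zConst, Derivation.leibniz_pow, nsmul_eq_mul, hc, zero_mul]

variable (k p) in
/-- The elements of `k(z)` killed by a power of `x∂` form a subfield: since `p`-th powers are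
constants, `f⁻¹ = f^{p-1} (f^p)⁻¹` is killed by a power of `x∂` if `f` is. -/
def zNilSubfield : Subfield (ZField k) where
  carrier := {f | ∃ n, (zEnd k ^ n) f = 0}
  mul_mem' := fun ⟨m, hm⟩ ⟨n, hn⟩ => ⟨m + n, zEnd_pow_mul_eq_zero _ m n _ _ le_rfl hm hn⟩
  one_mem' := ⟨1, by rw [pow_one]; exact (zDeriv k).map_one_eq_zero⟩
  add_mem' := fun ⟨m, hm⟩ ⟨n, hn⟩ => ⟨m + n, by
    rw [map_add, zEnd_pow_eq_zero_mono (Nat.le_add_right m n) hm,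
      zEnd_pow_eq_zero_mono (Nat.le_add_left n m) hn, add_zero]⟩
  zero_mem' := ⟨0, map_zero _⟩
  neg_mem' := fun ⟨m, hm⟩ => ⟨m, by rw [map_neg, hm, neg_zero]⟩
  inv_mem' := by
    rintro f ⟨n, hn⟩
    rcases eq_or_ne f 0 with rfl | hf
    · exact ⟨0, by rw [inv_zero, map_zero]⟩
    have hpow : ∀ i : ℕ, ∃ m, (zEnd k ^ m) (f ^ i) = 0 := by
      intro i
      induction i with
      | zero => exact ⟨1, by rw [pow_one, pow_zero]; exact (zDeriv k).map_one_eq_zero⟩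
      | succ i ih =>
        obtain ⟨m, hm⟩ := ih
        exact ⟨m + n, by rw [pow_succ]; exact zEnd_pow_mul_eq_zero _ m n _ _ le_rfl hm hn⟩
    obtain ⟨m, hm⟩ := hpow (p - 1)
    refine ⟨m, ?_⟩
    have : f⁻¹ = (f ^ p)⁻¹ * f ^ (p - 1) := by
      have h1 : f ^ p = f ^ (p - 1) * f := by
        rw [← pow_succ, Nat.sub_add_cancel hp.out.one_lt.le]
      rw [h1]
      field_simp
    rw [this, zEnd_pow_mul_of_mem_zConst (inv_mem_zConst (pow_mem_zConst p f)), hm, mul_zero]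

/-- The derivation `x∂` of `k(z)` is locally nilpotent. -/
theorem exists_zEnd_pow_eq_zero (p : ℕ) [Fact p.Prime] [CharP k p] (f : ZField k) :
    ∃ n, (zEnd k ^ n) f = 0 := by
  change f ∈ zNilSubfield k p
  have hconst : ∀ a : k, algebraMap k (ZField k) a ∈ zNilSubfield k p := fun a =>
    ⟨1, by rw [pow_one]; exact (zDeriv k).map_algebraMap a⟩
  have hvar : ∀ j, zvar k j ∈ zNilSubfield k p := by
    intro j
    induction j using Nat.strong_induction_on with
    | _ j ih =>
      have hD : zEnd k (zvar k j) ∈ zNilSubfield k p := by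
        change zDeriv k _ ∈ _
        rw [zDeriv_zvar]
        exact inv_mem (prod_mem fun i hi => ih i (Finset.mem_range.1 hi))
      obtain ⟨n, hn⟩ := hD
      exact ⟨n + 1, by rwa [pow_succ, Module.End.mul_apply]⟩
  have hpoly : ∀ P : MvPolynomial ℕ k,
      algebraMap (MvPolynomial ℕ k) (ZField k) P ∈ zNilSubfield k p := by
    intro P
    induction P using MvPolynomial.induction_on with
    | C a =>
      rw [← MvPolynomial.algebraMap_eq, ← IsScalarTower.algebraMap_apply]
      exact hconst a
    | add P Q hP hQ => rw [map_add]; exact add_mem hP hQ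
    | mul_X P j hP => rw [map_mul]; exact mul_mem hP (hvar j)
  obtain ⟨P, Q, _, rfl⟩ := IsFractionRing.div_surjective (A := MvPolynomial ℕ k) f
  exact div_mem (hpoly P) (hpoly Q)

/-- The only eigenvalue of `x∂` on `k(z)` is `0`. -/
theorem eq_zero_of_zDeriv_eq (p : ℕ) [Fact p.Prime] [CharP k p] {f : ZField k} {a : k}
    (h : zDeriv k f + algebraMap k (ZField k) a * f = 0) (ha : a ≠ 0) : f = 0 := by
  obtain ⟨n, hn⟩ := exists_zEnd_pow_eq_zero p f
  have hf : zEnd k f = (-a) • f := by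
    change zDeriv k f = _
    rw [Algebra.smul_def, map_neg, neg_mul]
    exact eq_neg_of_add_eq_zero_left h
  have hpow : ∀ n, (zEnd k ^ n) f = (-a) ^ n • f := by
    intro n
    induction n with
    | zero => simp
    | succ n ih =>
      rw [pow_succ, Module.End.mul_apply, hf, map_smul, ih, smul_smul, pow_succ']
  rw [hpow] at hn
  exact (smul_eq_zero.1 hn).resolve_left (pow_ne_zero _ (neg_ne_zero.2 ha))

/-! ### Monomials over the constants -/

theorem digits_unique {p : ℕ} (hp : 0 < p) : ∀ (N : ℕ) (a b : ℕ → ℕ), (∀ i, a i < p) →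
    (∀ i, b i < p) → ∑ i ∈ Finset.range N, p ^ i * a i = ∑ i ∈ Finset.range N, p ^ i * b i →
    ∀ i < N, a i = b i := by
  intro N
  induction N with
  | zero => intro a b _ _ _ i hi; omega
  | succ N ih =>
    intro a b ha hb h i hi
    have key : ∀ c : ℕ → ℕ, ∑ i ∈ Finset.range (N + 1), p ^ i * c i =
        c 0 + p * ∑ i ∈ Finset.range N, p ^ i * c (i + 1) := fun c => by
      rw [Finset.sum_range_succ', Finset.mul_sum, pow_zero, one_mul, add_comm]
      congr 1
      exact Finset.sum_congr rfl fun i _ => by ring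
    rw [key, key] at h
    have h0 : a 0 = b 0 := by
      have := congrArg (· % p) h
      simpa [Nat.add_mul_mod_self_left, Nat.mod_eq_of_lt (ha 0), Nat.mod_eq_of_lt (hb 0)] using this
    rw [h0, Nat.add_left_cancel_iff] at h
    have h' := ih (fun i => a (i + 1)) (fun i => b (i + 1)) (fun i => ha _) (fun i => hb _)
      (Nat.eq_of_mul_eq_mul_left hp h)
    rcases i with _ | i
    · exact h0
    · exact h' i (by omega)

theorem mod_eq_of_weight_eq {p : ℕ} (hp : 0 < p) {α β : ℕ →₀ ℕ} (h : weight p α = weight p β)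
    (i : ℕ) : α i % p = β i % p := by
  obtain ⟨N, hN⟩ : ∃ N, ∀ j, N ≤ j → α j = 0 ∧ β j = 0 := by
    refine ⟨(α.support ∪ β.support).sup id + 1, fun j hj => ?_⟩
    have hj' : j ∉ α.support ∪ β.support := fun hmem => by
      have := Finset.le_sup (f := id) hmem
      simp only [id] at this
      omega
    rw [Finset.mem_union, not_or, Finsupp.notMem_support_iff, Finsupp.notMem_support_iff] at hj'
    exact hj'
  have key : ∀ γ : ℕ →₀ ℕ, (∀ j, N ≤ j → γ j = 0) →
      weight p γ = ∑ i ∈ Finset.range N, p ^ i * (γ i % p) := fun γ hγ =>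
    Finsupp.sum_of_support_subset γ (fun j hj => by
      by_contra hj'
      exact Finsupp.mem_support_iff.1 hj (hγ j (by simpa using hj'))) _ (by simp)
  rcases lt_or_ge i N with hi | hi
  · rw [key α fun j hj => (hN j hj).1, key β fun j hj => (hN j hj).2] at h
    exact digits_unique hp N (fun i => α i % p) (fun i => β i % p) (fun i => Nat.mod_lt _ hp)
      (fun i => Nat.mod_lt _ hp) h i hi
  · rw [(hN i hi).1, (hN i hi).2]

/-- Monomials of the same weight agree up to a constant, as their exponents are congruent
modulo `p`. -/
theorem exists_zmon_eq_const_mul {α β : ℕ →₀ ℕ} (h : weight p α = weight p β) :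
    ∃ c ∈ zConst k, zmon k α = c * zmon k β := by
  have hpos := hp.out.pos
  refine ⟨zmon k (α + (p - 1) • β) * (zmon k (p • β))⁻¹, ?_, ?_⟩
  · refine mul_mem (zDeriv_zmon_of_dvd (p := p) fun j => ?_)
      (inv_mem_zConst (zDeriv_zmon_of_dvd (p := p) fun j => ?_))
    · have h1 := mod_eq_of_weight_eq hpos h j
      have h2 : (α j + (p - 1) * β j) % p = (β j + (p - 1) * β j) % p := by
        rw [Nat.add_mod, h1, ← Nat.add_mod]
      have h3 : β j + (p - 1) * β j = p * β j := by
        obtain ⟨q, rfl⟩ : ∃ q, p = q + 1 := ⟨p - 1, by omega⟩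
        rw [Nat.add_sub_cancel]; ring
      rw [h3, Nat.mul_mod_right] at h2
      rw [Finsupp.add_apply, Finsupp.smul_apply, smul_eq_mul]
      exact Nat.dvd_of_mod_eq_zero h2
    · rw [Finsupp.smul_apply, smul_eq_mul]; exact dvd_mul_right _ _
  · have h3 : p • β = (p - 1) • β + β := by
      rw [← succ_nsmul, Nat.sub_add_cancel hp.out.one_lt.le]
    rw [h3, zmon_add, zmon_add]
    field_simp [zmon_ne_zero (k := k) ((p - 1) • β), zmon_ne_zero (k := k) β]

variable (k p) in
/-- The span over the constants of the admissible monomials of weight at least `m`. -/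
def constSpan (m : ℕ) : Submodule (zConst k) (ZField k) :=
  Submodule.span (zConst k) (zmon k '' {α | α ∈ admissible p ∧ m ≤ weight p α})

/-- By induction on the weight: the power of `x∂` whose exponent is the largest possible weight sees
only the monomials of that weight, which span a line over the constants. -/
theorem eq_zero_of_mem_span_of_weight_lt {m : ℕ} (n : ℕ) {f : ZField k}
    (hf : f ∈ Submodule.span (zConst k)
      (zmon k '' {α | α ∈ admissible p ∧ m ≤ weight p α ∧ weight p α < n}))
    (h0 : (zEnd k ^ m) f = 0) : f = 0 := by
  induction n generalizing f with
  | zero =>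
    rw [show {α : ℕ →₀ ℕ | α ∈ admissible p ∧ m ≤ weight p α ∧ weight p α < 0} = ∅ by
      ext; simp] at hf
    simpa using hf
  | succ n ih =>
    by_cases hex : ∃ β : ℕ →₀ ℕ, β ∈ admissible p ∧ m ≤ weight p β ∧ weight p β = n
    · obtain ⟨β, hβ, hm, hn⟩ := hex
      have hle : Submodule.span (zConst k)
          (zmon k '' {α | α ∈ admissible p ∧ m ≤ weight p α ∧ weight p α < n + 1}) ≤
          Submodule.span (zConst k) (insert (zmon k β)
            (zmon k '' {α | α ∈ admissible p ∧ m ≤ weight p α ∧ weight p α < n})) := by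
        rw [Submodule.span_le]
        rintro _ ⟨α, ⟨hα, hmα, hnα⟩, rfl⟩
        rcases Nat.lt_succ_iff_lt_or_eq.1 hnα with h | h
        · exact Submodule.subset_span (Or.inr ⟨α, ⟨hα, hmα, h⟩, rfl⟩)
        · obtain ⟨c, hc, hcα⟩ := exists_zmon_eq_const_mul (k := k) (h.trans hn.symm)
          rw [hcα]
          exact Submodule.smul_mem _ (⟨c, hc⟩ : zConst k) (Submodule.subset_span (Or.inl rfl))
      obtain ⟨c, g, hg, rfl⟩ := Submodule.mem_span_insert.1 (hle hf)
      have hcm : ∀ (r : ℕ) (y : ZField k), (zEnd k ^ r) (c • y) = c • (zEnd k ^ r) y :=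
        fun r y => zEnd_pow_mul_of_mem_zConst c.2 r y
      have hgn : (zEnd k ^ n) g = 0 := by
        clear hf h0
        induction hg using Submodule.span_induction with
        | zero => exact map_zero _
        | add x y _ _ hx hy => rw [map_add, hx, hy, add_zero]
        | smul d x _ hx =>
          rw [show (zEnd k ^ n) (d • x) = d • (zEnd k ^ n) x from
            zEnd_pow_mul_of_mem_zConst d.2 n x, hx, smul_zero]
        | mem x hx =>
          obtain ⟨α, ⟨hα, _, h⟩, rfl⟩ := hx
          exact zEnd_pow_zmon_eq_zero p hα h
      have h1 := zEnd_pow_eq_zero_mono (hn ▸ hm) h0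
      rw [map_add, hgn, add_zero, hcm] at h1
      have hc0 : (c : ZField k) = 0 := by
        change (c : ZField k) * _ = 0 at h1
        exact (mul_eq_zero.1 h1).resolve_right (zEnd_pow_weight_zmon_ne_zero hβ hn)
      have hcz : c • zmon k β = 0 := by
        change (c : ZField k) * _ = 0
        rw [hc0, zero_mul]
      rw [hcz, zero_add] at h0 ⊢
      exact ih hg h0
    · have hsub : {α : ℕ →₀ ℕ | α ∈ admissible p ∧ m ≤ weight p α ∧ weight p α < n + 1} ⊆
          {α | α ∈ admissible p ∧ m ≤ weight p α ∧ weight p α < n} := by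
        intro α hα
        refine ⟨hα.1, hα.2.1, ?_⟩
        rcases Nat.lt_succ_iff_lt_or_eq.1 hα.2.2 with h | h
        · exact h
        · exact (hex ⟨α, hα.1, hα.2.1, h⟩).elim
      exact ih (Submodule.span_mono (Set.image_mono hsub) hf) h0

/-- The power `(x∂)^m` is injective on the span over the constants of the monomials of weight at
least `m`. -/
theorem eq_zero_of_mem_constSpan {m : ℕ} {f : ZField k} (hf : f ∈ constSpan k p m)
    (h0 : (zEnd k ^ m) f = 0) : f = 0 := by
  have hex : ∃ n, f ∈ Submodule.span (zConst k)
      (zmon k '' {α | α ∈ admissible p ∧ m ≤ weight p α ∧ weight p α < n}) := by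
    have hmono : ∀ {n n' : ℕ}, n ≤ n' → Submodule.span (zConst k)
        (zmon k '' {α | α ∈ admissible p ∧ m ≤ weight p α ∧ weight p α < n}) ≤
        Submodule.span (zConst k)
        (zmon k '' {α | α ∈ admissible p ∧ m ≤ weight p α ∧ weight p α < n'}) := fun h =>
      Submodule.span_mono (Set.image_mono fun α hα => ⟨hα.1, hα.2.1, hα.2.2.trans_le h⟩)
    clear h0
    induction hf using Submodule.span_induction with
    | zero => exact ⟨0, zero_mem _⟩
    | add x y _ _ hx hy =>
      obtain ⟨a, ha⟩ := hx
      obtain ⟨b, hb⟩ := hy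
      exact ⟨a + b, add_mem (hmono (Nat.le_add_right a b) ha) (hmono (Nat.le_add_left b a) hb)⟩
    | smul c x _ hx =>
      obtain ⟨a, ha⟩ := hx
      exact ⟨a, Submodule.smul_mem _ _ ha⟩
    | mem x hx =>
      obtain ⟨α, ⟨hα, h⟩, rfl⟩ := hx
      exact ⟨weight p α + 1, Submodule.subset_span ⟨α, ⟨hα, h, Nat.lt_succ_self _⟩, rfl⟩⟩
  obtain ⟨n, hn⟩ := hex
  exact eq_zero_of_mem_span_of_weight_lt n hn h0

omit hp [CharP k p] in
theorem span_le_constSpan {m : ℕ} {A : Set (ℕ →₀ ℕ)}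
    (hA : ∀ α ∈ A, α ∈ admissible p ∧ m ≤ weight p α) {f : ZField k}
    (hf : f ∈ Submodule.span k (zmon k '' A)) : f ∈ constSpan k p m := by
  induction hf using Submodule.span_induction with
  | zero => exact zero_mem _
  | add x y _ _ hx hy => exact add_mem hx hy
  | smul a x _ hx =>
    rw [Algebra.smul_def]
    exact Submodule.smul_mem _ (⟨_, algebraMap_mem_zConst a⟩ : zConst k) hx
  | mem x hx =>
    obtain ⟨α, hα, rfl⟩ := hx
    exact Submodule.subset_span ⟨α, hA α hα, rfl⟩

end Constants

/-! ### Polynomials in `x∂` -/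

section Polynomials

open Polynomial

variable {k : Type*} [Field k]

/-- The operator `f ↦ x∂ f + a f` on `k(z)`. -/
abbrev zShift (a : k) : Module.End k (ZField k) := zEnd k + algebraMap k _ a

theorem aeval_zShift (a : k) (χ : k[X]) :
    aeval (zShift a) χ = aeval (zEnd k) (χ.comp (X + C a)) := by
  rw [aeval_comp]
  simp

theorem aeval_zEnd_mem {W : Submodule k (ZField k)} (hW : ∀ f ∈ W, zEnd k f ∈ W) (q : k[X])
    {f : ZField k} (hf : f ∈ W) : aeval (zEnd k) q f ∈ W := by
  induction q using Polynomial.induction_on with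
  | C a => rw [aeval_C]; exact Submodule.smul_mem _ _ hf
  | add p q hp hq => rw [map_add]; exact add_mem hp hq
  | monomial n a h =>
    rw [pow_succ', ← mul_assoc, mul_comm (C a) X, mul_assoc, map_mul, aeval_X, Module.End.mul_apply]
    exact hW _ h

theorem aeval_zShift_mem {W : Submodule k (ZField k)} (hW : ∀ f ∈ W, zEnd k f ∈ W) (a : k)
    (q : k[X]) {f : ZField k} (hf : f ∈ W) : aeval (zShift a) q f ∈ W := by
  rw [aeval_zShift]
  exact aeval_zEnd_mem hW _ hf

/-- Factorization of `χ(x∂ + a)` into a power of `x∂` and a factor that is invertible because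
`x∂` is locally nilpotent. -/
theorem exists_aeval_zShift_eq {χ : k[X]} (hχ : χ ≠ 0) (a : k) :
    ∃ q : k[X], q.eval 0 ≠ 0 ∧
      aeval (zShift a) χ = aeval (zEnd k) q * zEnd k ^ χ.rootMultiplicity a := by
  obtain ⟨q, hq, hdvd⟩ := χ.exists_eq_pow_rootMultiplicity_mul_and_not_dvd hχ a
  refine ⟨q.comp (X + C a), ?_, ?_⟩
  · rw [dvd_iff_isRoot, IsRoot.def] at hdvd
    simpa using hdvd
  · rw [aeval_zShift]
    conv_lhs => rw [hq]
    rw [mul_comm, mul_comp, map_mul]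
    simp

theorem exists_mul_add_mul_X_pow_eq_one {q : k[X]} (hq : q.eval 0 ≠ 0) (n : ℕ) :
    ∃ r s : k[X], r * q + s * X ^ n = 1 := by
  have : IsCoprime q (X ^ n) := by
    refine IsCoprime.pow_right (IsCoprime.symm ?_)
    rw [Polynomial.irreducible_X.coprime_iff_not_dvd, X_dvd_iff, coeff_zero_eq_eval_zero]
    exact hq
  exact this

variable {p : ℕ} [hp : Fact p.Prime] [CharP k p]

/-- The operator `χ(x∂ + a)` lowers the bound on the first exponent by the multiplicity of `a`. -/
theorem aeval_zShift_mem_admSpan {χ : k[X]} (hχ : χ ≠ 0) (a : k) {N : ℕ} {f : ZField k}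
    (hf : f ∈ admSpan k p (N + χ.rootMultiplicity a)) :
    aeval (zShift a) χ f ∈ admSpan k p N := by
  obtain ⟨q, _, h⟩ := exists_aeval_zShift_eq hχ a
  rw [h, Module.End.mul_apply]
  exact aeval_zEnd_mem (fun f hf => zEnd_stable_admSpan hf) q (zEnd_pow_mem_admSpan _ hf)

/-- Preimages under `χ(x∂ + a)`: invert the unit factor first, which preserves the bound on the
first exponent, then take a preimage under the power of `x∂` and drop its terms of small weight. -/
theorem exists_aeval_zShift_apply_eq {χ : k[X]} (hχ : χ ≠ 0) (a : k) {N : ℕ} {g : ZField k}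
    (hg : g ∈ admSpan k p N) :
    ∃ f ∈ Submodule.span k (zmon k '' {α | (α ∈ admissible p ∧
      α 0 < N + χ.rootMultiplicity a) ∧ χ.rootMultiplicity a ≤ weight p α}),
      aeval (zShift a) χ f = g := by
  obtain ⟨q, hq, h⟩ := exists_aeval_zShift_eq hχ a
  obtain ⟨r, s, hrs⟩ := exists_mul_add_mul_X_pow_eq_one hq N
  obtain ⟨f', hf', hf'g⟩ := exists_zEnd_pow_eq (χ.rootMultiplicity a)
    (aeval_zEnd_mem (fun f hf => zEnd_stable_admSpan hf) r hg)
  obtain ⟨f, hf, hff'⟩ := exists_weight_le_zEnd_pow_eq hf'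
  refine ⟨f, hf, ?_⟩
  have h1 : (r * q + s * X ^ N) = q * r + s * X ^ N := by rw [mul_comm r]
  have h2 := congrArg (fun P => aeval (zEnd k) P g) (h1 ▸ hrs)
  simp only [map_add, map_mul, map_pow, aeval_X, map_one, LinearMap.add_apply,
    Module.End.mul_apply, Module.End.one_apply, zEnd_pow_eq_zero_of_mem_admSpan hg, map_zero,
    add_zero] at h2
  rw [h, Module.End.mul_apply, hff', hf'g, h2]

theorem eq_zero_of_aeval_zShift_eq_zero {χ : k[X]} (hχ : χ ≠ 0) (a : k) {f : ZField k}
    (hf : f ∈ constSpan k p (χ.rootMultiplicity a)) (h0 : aeval (zShift a) χ f = 0) : f = 0 := by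
  obtain ⟨q, hq, h⟩ := exists_aeval_zShift_eq hχ a
  rw [h, Module.End.mul_apply] at h0
  refine eq_zero_of_mem_constSpan hf ?_
  obtain ⟨n, hn⟩ := exists_zEnd_pow_eq_zero p ((zEnd k ^ χ.rootMultiplicity a) f)
  obtain ⟨r, s, hrs⟩ := exists_mul_add_mul_X_pow_eq_one hq n
  have h2 := congrArg (fun P => aeval (zEnd k) P ((zEnd k ^ χ.rootMultiplicity a) f)) hrs
  simp only [map_add, map_mul, map_pow, aeval_X, map_one, LinearMap.add_apply,
    Module.End.mul_apply, Module.End.one_apply, h0, hn, map_zero, add_zero] at h2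
  exact h2.symm

end Polynomials

/-! ### The action of operators on coefficients -/

section Action

variable {k : Type*} [Field k]

/-- The coefficient of `t^σ x^n`, an element of `k(z)`. -/
def coef (σ : k) (n : ℤ) : Closure k →ₗ[k] ZField k where
  toFun f := (f.coeff σ).coeff n
  map_add' _ _ := rfl
  map_smul' _ _ := rfl

theorem coef_apply (σ : k) (n : ℤ) (f : Closure k) : coef σ n f = (f.coeff σ).coeff n := rfl

theorem ext_coef {f g : Closure k} (h : ∀ σ n, coef σ n f = coef σ n g) : f = g := by
  ext σ : 2
  exact HahnSeries.ext (funext fun n => h σ n)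

theorem coef_single_of_ne {ρ σ : k} (h : σ ≠ ρ) (n : ℤ) (g : LaurentSeries (ZField k)) :
    coef σ n (AddMonoidAlgebra.single ρ g) = 0 := by
  rw [coef_apply, AddMonoidAlgebra.coeff_single, Finsupp.single_eq_of_ne h, HahnSeries.coeff_zero]

theorem coef_single_self (ρ : k) (n : ℤ) (g : LaurentSeries (ZField k)) :
    coef ρ n (AddMonoidAlgebra.single ρ g) = g.coeff n := by
  rw [coef_apply, AddMonoidAlgebra.coeff_single, Finsupp.single_eq_same]

theorem zShift_apply (a : k) (f : ZField k) :
    zShift a f = zDeriv k f + algebraMap k (ZField k) a * f := by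
  change zDeriv k f + _ = _
  rw [Module.algebraMap_end_apply, Algebra.smul_def]

theorem coef_del (σ : k) (n : ℤ) (f : Closure k) :
    coef σ n (del k f) = zShift ((n + 1 : ℤ) + σ) (coef σ (n + 1) f) := by
  induction f using AddMonoidAlgebra.induction_linear with
  | zero => simp only [map_zero]
  | add f g hf hg => simp only [map_add, hf, hg]
  | single ρ g =>
    rw [del_single]
    by_cases h : σ = ρ
    · subst h
      rw [coef_single_self, coef_single_self, coeff_laurentDel, zShift_apply]
    · rw [coef_single_of_ne h, coef_single_of_ne h, map_zero]

/-- The coefficients of `∂^j f`, by `x^j ∂^j = θ (θ - 1) ⋯ (θ - j + 1)` with `θ = x∂`. -/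
theorem coef_del_pow (σ : k) (j : ℕ) (n : ℤ) (f : Closure k) :
    coef σ n (((del k : Closure k →ₗ[k] Closure k) ^ j) f) =
      Polynomial.aeval (zShift ((n + j : ℤ) + σ)) (descPochhammer k j) (coef σ (n + j) f) := by
  induction j generalizing n with
  | zero => simp
  | succ j ih =>
    have h1 : (n + 1 + j : ℤ) = n + (j + 1 : ℕ) := by push_cast; ring
    have h2 : zShift ((n + 1 : ℤ) + σ) =
        zShift ((n + (j + 1 : ℕ) : ℤ) + σ) - (j : Module.End k (ZField k)) := by
      rw [zShift, zShift, add_sub_assoc, ← map_natCast (algebraMap k (Module.End k (ZField k))) j,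
        ← map_sub]
      congr 2
      push_cast; ring
    have h3 := coef_del σ n (((del k : Closure k →ₗ[k] Closure k) ^ j) f)
    rw [pow_succ', Module.End.mul_apply]
    refine h3.trans ?_
    rw [ih, h1, h2, descPochhammer_succ_right, mul_comm, map_mul, Module.End.mul_apply]
    simp

theorem coeff_ofSeries_mul (q : PowerSeries k) (f : Closure k) (σ : k) :
    (ofSeries k q * f).coeff σ =
      HahnSeries.ofPowerSeries ℤ (ZField k) (q.map (algebraMap k (ZField k))) * f.coeff σ := by
  rw [ofSeries, AddMonoidAlgebra.coeff_single_mul_apply, neg_zero, zero_add]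

/-- Multiplication by a power series divisible by `x^{d+1}` involves only coefficients of degree
less than `n - d`. -/
theorem coef_ofSeries_mul_mem (W : Submodule k (ZField k)) {q : PowerSeries k} {d : ℕ}
    (hq : ∀ i ≤ d, PowerSeries.coeff i q = 0) {σ : k} {n : ℤ} {f : Closure k}
    (hf : ∀ n' < n - d, coef σ n' f ∈ W) : coef σ n (ofSeries k q * f) ∈ W := by
  rw [coef_apply, coeff_ofSeries_mul, HahnSeries.coeff_mul]
  refine Submodule.sum_mem _ fun ij hij => ?_
  obtain ⟨hi, _, hij⟩ := Finset.mem_antidiagonal.1 hij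
  have hi' : ∃ m : ℕ, (m : ℤ) = ij.1 := by
    by_contra hne
    refine hi ?_
    rw [HahnSeries.ofPowerSeries_apply]
    exact HahnSeries.embDomain_of_notMem_range fun ⟨m, hm⟩ => hne ⟨m, hm⟩
  obtain ⟨m, hm⟩ := hi'
  rw [← hm, HahnSeries.ofPowerSeries_apply_coeff, PowerSeries.coeff_map, ← Algebra.smul_def]
  refine Submodule.smul_mem _ _ ?_
  rcases le_or_gt m d with h | h
  · refine (hi ?_).elim
    rw [← hm, HahnSeries.ofPowerSeries_apply_coeff, PowerSeries.coeff_map, hq m h, map_zero]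
  · exact hf _ (by omega)

theorem ofSeries_monomial (j : ℕ) (c : k) : ofSeries k (PowerSeries.monomial j c) =
    AddMonoidAlgebra.single 0 (HahnSeries.single (j : ℤ) (algebraMap k (ZField k) c)) := by
  rw [ofSeries]
  congr 1
  ext n
  by_cases h : ∃ m : ℕ, (m : ℤ) = n
  · obtain ⟨m, rfl⟩ := h
    rw [HahnSeries.ofPowerSeries_apply_coeff, PowerSeries.coeff_map, PowerSeries.coeff_monomial,
      HahnSeries.coeff_single]
    by_cases hm : m = j
    · simp [hm]
    · rw [if_neg hm, if_neg (by exact_mod_cast hm), map_zero]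
  · rw [HahnSeries.ofPowerSeries_apply,
      HahnSeries.embDomain_of_notMem_range fun ⟨m, hm⟩ => h ⟨m, hm⟩,
      HahnSeries.coeff_single, if_neg fun h' => h ⟨j, h'.symm⟩]

theorem act_apply (L : DiffOp k) (f : Closure k) :
    act L f = L.sum fun j q => ofSeries k q * ((del k : Closure k →ₗ[k] Closure k) ^ j) f := by
  rw [act, Finsupp.sum, LinearMap.sum_apply]
  rfl

theorem ofSeries_add (q r : PowerSeries k) : ofSeries k (q + r) = ofSeries k q + ofSeries k r := by
  rw [ofSeries, map_add, map_add, AddMonoidAlgebra.single_add]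
  rfl

theorem ofSeries_zero : ofSeries k (0 : PowerSeries k) = 0 := by
  rw [ofSeries, map_zero, map_zero, AddMonoidAlgebra.single_zero]

theorem act_add (L M : DiffOp k) (f : Closure k) : act (L + M) f = act L f + act M f := by
  rw [act_apply, act_apply, act_apply, Finsupp.sum_add_index']
  · intro j; rw [ofSeries_zero, zero_mul]
  · intro j q r; rw [ofSeries_add, add_mul]

/-- The initial form acts on the coefficient of `t^σ x^n` by the indicial polynomial of
`x∂ + n + σ`. -/
theorem coef_act_eulerPart (L : DiffOp k) (σ : k) (n : ℤ) (f : Closure k) :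
    coef σ n (act (eulerPart L 0) f) =
      Polynomial.aeval (zShift (n + σ)) (indicial L) (coef σ n f) := by
  have hsupp : (eulerPart L 0).support ⊆ L.support := Finsupp.support_onFinset_subset
  have hj : ∀ j, eulerPart L 0 j = PowerSeries.monomial j (PowerSeries.coeff j (L j)) := by
    intro j
    ext i
    rw [PowerSeries.coeff_monomial]
    change PowerSeries.coeff i (PowerSeries.mk fun i : ℕ =>
      if (i : ℤ) - j = 0 then PowerSeries.coeff i (L j) else 0) = _
    rw [PowerSeries.coeff_mk]
    by_cases h : i = j
    · simp [h]
    · rw [if_neg h, if_neg (by omega)]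
  rw [act_apply, Finsupp.sum_of_support_subset _ hsupp _
    (fun j _ => by rw [ofSeries_zero, zero_mul]), map_sum, indicial, Finsupp.sum, map_sum,
    LinearMap.sum_apply]
  refine Finset.sum_congr rfl fun j _ => ?_
  rw [hj, ofSeries_monomial, coef_apply, AddMonoidAlgebra.coeff_single_mul_apply, neg_zero,
    zero_add, HahnSeries.coeff_single_mul, ← coef_apply, coef_del_pow, sub_add_cancel, map_mul,
    Polynomial.aeval_C, Module.End.mul_apply, Module.algebraMap_end_apply, Algebra.smul_def]

theorem coeff_eq_zero_of_hasShift {L : DiffOp k} (hL : HasShift L 0) {i j : ℕ} (h : i < j) :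
    PowerSeries.coeff i (L j) = 0 := by
  by_contra hne
  have := hL.2 ⟨i, j, hne, rfl⟩
  omega

theorem indicial_ne_zero {L : DiffOp k} (hL : HasShift L 0) : indicial L ≠ 0 := by
  classical
  obtain ⟨i, j, hij, h⟩ := hL.1
  obtain rfl : i = j := by omega
  have hi : i ∈ L.support.filter fun j => PowerSeries.coeff j (L j) ≠ 0 := by
    refine Finset.mem_filter.2 ⟨Finsupp.mem_support_iff.2 fun h0 => hij ?_, hij⟩
    rw [h0, map_zero]
  -- the term with the largest `j` determines the leading coefficient
  obtain ⟨J, hJ, hmax⟩ := Finset.exists_max_image _ id ⟨i, hi⟩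
  obtain ⟨hJ, hJ0⟩ := Finset.mem_filter.1 hJ
  intro h0
  have hc := congrArg (Polynomial.coeff · J) h0
  simp only [indicial, Finsupp.sum, Polynomial.finsetSum_coeff, Polynomial.coeff_C_mul,
    Polynomial.coeff_zero] at hc
  rw [Finset.sum_eq_single_of_mem J hJ] at hc
  · have hlead : (descPochhammer k J).coeff J = 1 := by
      have := (monic_descPochhammer k J).coeff_natDegree
      rwa [descPochhammer_natDegree] at this
    rw [hlead, mul_one] at hc
    exact hJ0 hc
  · intro l hl hlJ
    by_cases hl0 : PowerSeries.coeff l (L l) = 0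
    · rw [hl0, zero_mul]
    · have hle : l ≤ J := hmax l (Finset.mem_filter.2 ⟨hl, hl0⟩)
      rw [Polynomial.coeff_eq_zero_of_natDegree_lt, mul_zero]
      rw [descPochhammer_natDegree]
      omega

/-- The operator `L₀ - L` raises the order: its value at degree `n` depends on coefficients of
degree less than `n` only. -/
theorem coef_act_eulerPart_sub_act_mem {L : DiffOp k} (hL : HasShift L 0)
    (W : Submodule k (ZField k)) (hW : ∀ g ∈ W, zEnd k g ∈ W) {σ : k} {n : ℤ} {f : Closure k}
    (hf : ∀ n' < n, coef σ n' f ∈ W) :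
    coef σ n (act (eulerPart L 0) f - act L f) ∈ W := by
  have h1 : act (eulerPart L 0) f - act L f = act (eulerPart L 0 - L) f := by
    rw [sub_eq_iff_eq_add, ← act_add, sub_add_cancel]
  rw [h1, act_apply, Finsupp.sum, map_sum]
  refine Submodule.sum_mem _ fun j _ => coef_ofSeries_mul_mem W (d := j) (fun i hi => ?_)
    (fun n' hn' => ?_)
  · rw [Finsupp.sub_apply, map_sub]
    change PowerSeries.coeff i (PowerSeries.mk fun i : ℕ =>
      if (i : ℤ) - j = 0 then PowerSeries.coeff i (L j) else 0) - _ = _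
    rw [PowerSeries.coeff_mk]
    rcases hi.lt_or_eq with hi | rfl
    · rw [if_neg (by omega), coeff_eq_zero_of_hasShift hL hi, sub_zero]
    · rw [if_pos (by omega), sub_self]
  · rw [coef_del_pow]
    exact aeval_zShift_mem hW _ _ (hf _ (by omega))

theorem act_const_mul (L : DiffOp k) {c : Closure k} (hc : del k c = 0) (f : Closure k) :
    act L (c * f) = c * act L f := by
  have hpow : ∀ j : ℕ, ((del k : Closure k →ₗ[k] Closure k) ^ j) (c * f) =
      c * ((del k : Closure k →ₗ[k] Closure k) ^ j) f := by
    intro j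
    induction j with
    | zero => rfl
    | succ j ih =>
      rw [pow_succ', Module.End.mul_apply, Module.End.mul_apply, ih]
      change del k _ = c * del k _
      rw [Derivation.leibniz, hc, smul_zero, add_zero, smul_eq_mul]
  rw [act_apply, act_apply, Finsupp.sum, Finsupp.sum, Finset.mul_sum]
  refine Finset.sum_congr rfl fun j _ => ?_
  rw [hpow]; ring

variable {p : ℕ} [hp : Fact p.Prime] [CharP k p]

/-- The constants of `R`: the coefficient of `t^σ x^n` is a constant of `k(z)`, and it vanishes
unless `n + σ = 0` in `k`. -/
theorem coef_of_del_eq_zero (p : ℕ) [Fact p.Prime] [CharP k p] {c : Closure k}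
    (hc : del k c = 0) (σ : k) (n : ℤ) :
    coef σ n c ∈ zConst k ∧ (coef σ n c ≠ 0 → (n : k) + σ = 0) := by
  have h := coef_del σ (n - 1) c
  rw [hc, map_zero, sub_add_cancel, zShift_apply] at h
  have h0 : coef σ n c ≠ 0 → (n : k) + σ = 0 := fun hne => by
    by_contra ha
    exact hne (eq_zero_of_zDeriv_eq p h.symm ha)
  refine ⟨?_, h0⟩
  by_cases hz : coef σ n c = 0
  · rw [hz]; exact zero_mem _
  · rw [h0 hz, map_zero, zero_mul, add_zero] at h
    exact h.symm

/-- If the coefficients of `t^ρ x^n` in `f` lie in `(x∂)`-constant spans that depend only on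
`n + ρ ∈ k`, the same holds for products of `f` with constants. -/
theorem coef_const_mul_mem {c : Closure k} (hc : del k c = 0) {ρ : k} {m : k → ℕ}
    {f : Closure k} (hf : ∀ σ, σ ≠ ρ → f.coeff σ = 0)
    (hfm : ∀ n : ℤ, coef ρ n f ∈ constSpan k p (m (n + ρ))) (σ : k) (n : ℤ) :
    coef σ n (c * f) ∈ constSpan k p (m (n + σ)) := by
  have hf' : f = AddMonoidAlgebra.single ρ (f.coeff ρ) := by
    ext σ : 2
    by_cases h : σ = ρ
    · rw [h, AddMonoidAlgebra.coeff_single, Finsupp.single_eq_same]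
    · rw [AddMonoidAlgebra.coeff_single, Finsupp.single_eq_of_ne h, hf σ h]
  rw [hf', coef_apply, AddMonoidAlgebra.coeff_mul_single_apply, HahnSeries.coeff_mul]
  refine Submodule.sum_mem _ fun ij hij => ?_
  obtain ⟨hi, _, hij⟩ := Finset.mem_antidiagonal.1 hij
  obtain ⟨h1, h2⟩ := coef_of_del_eq_zero p hc (σ + -ρ) ij.1
  have h3 : ((n : ℤ) : k) + σ = ij.2 + ρ := by
    have h4 := h2 hi
    rw [← hij]
    push_cast
    linear_combination h4
  rw [h3]
  exact Submodule.smul_mem _ (⟨_, h1⟩ : zConst k) (hfm ij.2)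

end Action

/-! ### The `x`-adic filtration -/

section Filtration

variable {k : Type*} [Field k]

variable (k) in
/-- The elements of `R` of order at least `N` in `x`. -/
def ordGE (N : ℤ) : Submodule k (Closure k) where
  carrier := {f | ∀ σ, ∀ n < N, coef σ n f = 0}
  zero_mem' := fun _ _ _ => map_zero _
  add_mem' hf hg := fun σ n hn => by rw [map_add, hf σ n hn, hg σ n hn, add_zero]
  smul_mem' c _ hf := fun σ n hn => by rw [map_smul, hf σ n hn, smul_zero]

theorem mem_ordGE {N : ℤ} {f : Closure k} : f ∈ ordGE k N ↔ ∀ σ, ∀ n < N, coef σ n f = 0 := Iff.rfl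

theorem ordGE_anti {M N : ℤ} (h : M ≤ N) : ordGE k N ≤ ordGE k M :=
  fun _ hf σ n hn => hf σ n (hn.trans_le h)

theorem eq_zero_of_forall_mem_ordGE {f : Closure k} (h : ∀ N : ℕ, f ∈ ordGE k N) : f = 0 :=
  ext_coef fun σ n => by
    rw [map_zero]
    exact h (n.toNat + 1) σ n (by push_cast; omega)

theorem hasBasis_nhds (f : Closure k) :
    (nhds f).HasBasis (fun _ : ℤ => True) fun N => {g | g - f ∈ ordGE k N} := by
  have hiff : ∀ (f g : Closure k) (N : ℤ), g - f ∈ ordGE k N ↔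
      ∀ σ : k, ∀ n < N, (g.coeff σ).coeff n = (f.coeff σ).coeff n := fun f g N => by
    rw [mem_ordGE]
    refine forall_congr' fun σ => forall_congr' fun n => forall_congr' fun _ => ?_
    rw [map_sub, sub_eq_zero]
    rfl
  refine ⟨fun U => ?_⟩
  rw [mem_nhds_iff]
  constructor
  · rintro ⟨V, hVU, hV, hf⟩
    obtain ⟨N, hN⟩ := hV f hf
    exact ⟨N, trivial, fun g hg => hVU (hN g ((hiff f g N).1 hg))⟩
  · rintro ⟨N, -, hN⟩
    refine ⟨_, hN, fun g hg => ⟨N, fun h hh => ?_⟩, ?_⟩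
    · have := add_mem ((hiff g h N).2 hh) hg
      rwa [sub_add_sub_cancel] at this
    · change f - f ∈ ordGE k N
      rw [sub_self]
      exact zero_mem _

/-- Multiplication by a fixed element of `R` lowers the order by a bounded amount. -/
theorem exists_mul_mem_ordGE (c : Closure k) :
    ∃ M : ℤ, ∀ (N : ℤ) (f : Closure k), f ∈ ordGE k N → c * f ∈ ordGE k (N - M) := by
  induction c using AddMonoidAlgebra.induction_linear with
  | zero => exact ⟨0, fun N f _ => by rw [zero_mul]; exact zero_mem _⟩
  | add c d hc hd =>
    obtain ⟨M, hM⟩ := hc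
    obtain ⟨M', hM'⟩ := hd
    refine ⟨max M M', fun N f hf => ?_⟩
    rw [add_mul]
    exact add_mem (ordGE_anti (by omega) (hM N f hf)) (ordGE_anti (by omega) (hM' N f hf))
  | single ρ g =>
    refine ⟨-g.order, fun N f hf σ n hn => ?_⟩
    rw [coef_apply, AddMonoidAlgebra.coeff_single_mul_apply, HahnSeries.coeff_mul]
    refine Finset.sum_eq_zero fun ij hij => ?_
    obtain ⟨hi, _, hij⟩ := Finset.mem_antidiagonal.1 hij
    have h1 := HahnSeries.order_le_of_coeff_ne_zero hi
    have h2 : (f.coeff (-ρ + σ)).coeff ij.2 = 0 := hf _ _ (by omega)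
    rw [h2, mul_zero]

end Filtration

/-! ### Geometric series in filtered spaces -/

section Geometric

variable {k V : Type*} [Field k] [AddCommGroup V] [Module k V] {G : ℤ → Submodule k V}
  {N : V →ₗ[k] V}

theorem pow_mem_filtration (h0 : ∀ f, f ∈ G 0) (hN : ∀ j, ∀ f ∈ G j, N f ∈ G (j + 1))
    (m : ℕ) (f : V) : (N ^ m) f ∈ G m := by
  induction m with
  | zero => exact h0 f
  | succ m ih =>
    rw [pow_succ', Module.End.mul_apply]
    exact_mod_cast hN m _ ih

theorem mem_filtration_of_sub_mem (hG : Antitone G) (h0 : ∀ f, f ∈ G 0)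
    (hN : ∀ j, ∀ f ∈ G j, N f ∈ G (j + 1)) (j : ℤ) (f : V) (hf : f - N f ∈ G j) : f ∈ G j := by
  have key : ∀ i : ℕ, (i : ℤ) ≤ j → f ∈ G i := by
    intro i
    induction i with
    | zero => intro _; exact h0 f
    | succ i ih =>
      intro hi
      have h1 := add_mem (hG hi hf) (hN i f (ih (by omega)))
      rwa [sub_add_cancel] at h1
  rcases le_or_gt 0 j with h | h
  · have := key j.toNat (by omega)
    rwa [Int.toNat_of_nonneg h] at this
  · exact hG h.le (h0 f)

theorem sub_geom_sum (m : ℕ) (f : V) :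
    ∑ i ∈ Finset.range m, (N ^ i) f - N (∑ i ∈ Finset.range m, (N ^ i) f) = f - (N ^ m) f := by
  induction m with
  | zero => simp
  | succ m ih =>
    rw [Finset.sum_range_succ, map_add, add_sub_add_comm, ih, pow_succ', Module.End.mul_apply]
    abel

variable [TopologicalSpace V]

theorem continuous_of_filtration
    (hb : ∀ f : V, (nhds f).HasBasis (fun _ : ℤ => True) fun j => {g | g - f ∈ G j})
    (φ : V →ₗ[k] V) (h : ∀ j, ∀ f ∈ G j, φ f ∈ G j) : Continuous φ := by
  rw [continuous_iff_continuousAt]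
  intro f
  refine ((hb f).tendsto_iff (hb (φ f))).2 fun j _ => ⟨j, trivial, fun g hg => ?_⟩
  have := h j (g - f) hg
  rwa [map_sub] at this

/-- If `N` raises the order with respect to a separated and complete filtration, `Id - N` is an
automorphism, and the partial sums of the geometric series approximate its inverse. -/
theorem exists_equiv_sub (hG : Antitone G) (h0 : ∀ f, f ∈ G 0)
    (hb : ∀ f : V, (nhds f).HasBasis (fun _ : ℤ => True) fun j => {g | g - f ∈ G j})
    (hsep : ∀ f, (∀ j : ℕ, f ∈ G j) → f = 0)
    (hcomplete : ∀ a : ℕ → V, (∀ j : ℕ, a (j + 1) - a j ∈ G j) → ∃ g, ∀ j : ℕ, g - a j ∈ G j)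
    (hN : ∀ j, ∀ f ∈ G j, N f ∈ G (j + 1)) :
    ∃ u : V ≃L[k] V, (∀ f, u f = f - N f) ∧
      ∀ (j : ℕ) (f : V), u.symm f - ∑ i ∈ Finset.range j, (N ^ i) f ∈ G j := by
  have hinj : Function.Injective (LinearMap.id - N : V →ₗ[k] V) := by
    rw [injective_iff_map_eq_zero]
    intro f hf
    refine hsep f fun j => mem_filtration_of_sub_mem hG h0 hN j f ?_
    change f - N f = 0 at hf
    rw [hf]
    exact zero_mem _
  have hsurj : Function.Surjective (LinearMap.id - N : V →ₗ[k] V) := by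
    intro f
    obtain ⟨g, hg⟩ := hcomplete (fun j => ∑ i ∈ Finset.range j, (N ^ i) f) (fun j => by
      rw [Finset.sum_range_succ, add_sub_cancel_left]
      exact pow_mem_filtration h0 hN j f)
    refine ⟨g, sub_eq_zero.1 (hsep _ fun j => ?_)⟩
    have h1 : (LinearMap.id - N : V →ₗ[k] V) g - f =
        (g - ∑ i ∈ Finset.range j, (N ^ i) f) - N (g - ∑ i ∈ Finset.range j, (N ^ i) f) -
          (N ^ j) f := by
      rw [map_sub N, sub_sub_sub_comm, sub_geom_sum, LinearMap.sub_apply, LinearMap.id_apply]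
      abel
    rw [h1]
    exact sub_mem (sub_mem (hg j) (hG (by omega) (hN j _ (hg j)))) (pow_mem_filtration h0 hN j f)
  let e := LinearEquiv.ofBijective (LinearMap.id - N : V →ₗ[k] V) ⟨hinj, hsurj⟩
  have he : ∀ f, e f = f - N f := fun f => rfl
  have hsymm : ∀ f, e.symm f - N (e.symm f) = f := fun f => e.apply_symm_apply f
  refine ⟨⟨e, ?_, ?_⟩, he, fun j f => ?_⟩
  · exact continuous_of_filtration hb (e : V →ₗ[k] V) fun j f hf =>
      sub_mem hf (hG (by omega) (hN j f hf))
  · refine continuous_of_filtration hb (e.symm : V →ₗ[k] V) fun j f hf => ?_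
    refine mem_filtration_of_sub_mem hG h0 hN j _ ?_
    rw [LinearEquiv.coe_coe, hsymm]
    exact hf
  · refine mem_filtration_of_sub_mem hG h0 hN j _ ?_
    change e.symm f - _ - N (e.symm f - _) ∈ _
    rw [map_sub, sub_sub_sub_comm, hsymm, sub_geom_sum, sub_sub_cancel]
    exact pow_mem_filtration h0 hN j f

theorem hasSum_geometric (hG : Antitone G) (h0 : ∀ f, f ∈ G 0)
    (hb : ∀ f : V, (nhds f).HasBasis (fun _ : ℤ => True) fun j => {g | g - f ∈ G j})
    (hN : ∀ j, ∀ f ∈ G j, N f ∈ G (j + 1)) {f g : V}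
    (h : ∀ j : ℕ, g - ∑ i ∈ Finset.range j, (N ^ i) f ∈ G j) :
    HasSum (fun n : ℕ => (N ^ n) f) g := by
  rw [HasSum, SummationFilter.unconditional_filter, (hb g).tendsto_right_iff]
  intro M _
  refine Filter.eventually_atTop.2 ⟨Finset.range M.toNat, fun s hs => ?_⟩
  have h1 : ∑ i ∈ s, (N ^ i) f - g = ∑ i ∈ s \ Finset.range M.toNat, (N ^ i) f -
      (g - ∑ i ∈ Finset.range M.toNat, (N ^ i) f) := by
    rw [← Finset.sum_sdiff hs]; abel
  change ∑ i ∈ s, (N ^ i) f - g ∈ G M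
  rw [h1]
  refine sub_mem (Submodule.sum_mem _ fun i hi => hG ?_ (pow_mem_filtration h0 hN i f))
    (hG (by omega) (h M.toNat))
  have := (Finset.mem_sdiff.1 hi).2
  rw [Finset.mem_range] at this
  omega

end Geometric

/-- The automorphism `Id - N` of a complete subspace `F` of a space `R` with a separated filtration,
for an endomorphism `N` of `F` that raises the order. -/
theorem exists_equiv_sub_of_submodule {k R : Type*} [Field k] [AddCommGroup R] [Module k R]
    [TopologicalSpace R] {O : ℤ → Submodule k R} (hO : Antitone O)
    (hb : ∀ f : R, (nhds f).HasBasis (fun _ : ℤ => True) fun j => {g | g - f ∈ O j})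
    (hsep : ∀ f, (∀ j : ℕ, f ∈ O j) → f = 0) {F : Submodule k R} (hF : F ≤ O 0)
    (hcomplete : ∀ a : ℕ → R, (∀ j, a j ∈ F) → (∀ j : ℕ, a (j + 1) - a j ∈ O j) →
      ∃ g ∈ F, ∀ j : ℕ, g - a j ∈ O j)
    (N : F →ₗ[k] F) (hN : ∀ j, ∀ f : F, (f : R) ∈ O j → (N f : R) ∈ O (j + 1)) :
    ∃ u : F ≃L[k] F, (∀ f : F, (u f : R) = f - N f) ∧
      (∀ (j : ℕ) (f : F),
        (u.symm f : R) - ((∑ i ∈ Finset.range j, (N ^ i) f : F) : R) ∈ O j) ∧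
      ∀ f, HasSum (fun n : ℕ => (N ^ n) f) (u.symm f) := by
  have hG : Antitone fun j => (O j).comap F.subtype := fun _ _ hij => Submodule.comap_mono (hO hij)
  have h0 : ∀ f : F, f ∈ (O 0).comap F.subtype := fun f => hF f.2
  have hbF : ∀ f : F, (nhds f).HasBasis (fun _ : ℤ => True)
      fun j => {g | g - f ∈ (O j).comap F.subtype} := fun f => by
    rw [nhds_subtype_eq_comap]
    exact (hb (f : R)).comap _
  obtain ⟨u, hu, h⟩ := exists_equiv_sub hG h0 hbF (fun f hf => Subtype.ext (hsep f hf))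
    (fun a ha => by
      obtain ⟨g, hg, h⟩ := hcomplete (fun j => (a j : R)) (fun j => (a j).2) ha
      exact ⟨⟨g, hg⟩, h⟩) hN
  exact ⟨u, fun f => congrArg Subtype.val (hu f), h,
    fun f => hasSum_geometric hG h0 hbF hN fun j => h j f⟩

/-! ### Linearity over the constants -/

section ConstLinear

variable {k : Type*} [Field k] {F : Submodule k (Closure k)} {N : F →ₗ[k] F}

theorem IsConstLinear.pow (hC : IsConstLinear fun f : F => (N f : Closure k)) (m : ℕ) :
    IsConstLinear fun f : F => ((N ^ m) f : Closure k) := by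
  induction m with
  | zero => intro n c f g _ h; exact h
  | succ m ih =>
    intro n c f g hc h
    simp only [pow_succ', Module.End.mul_apply]
    exact hC n c (fun i => (N ^ m) (f i)) ((N ^ m) g) hc (ih n c f g hc h)

/-- The sum of a geometric series of constant-linear maps is constant-linear, as multiplication by
constants is continuous. -/
theorem isConstLinear_of_sub_sum_mem_ordGE (hC : IsConstLinear fun f : F => (N f : Closure k))
    {v : F → F}
    (hv : ∀ (j : ℕ) (f : F),
      (v f : Closure k) - ((∑ i ∈ Finset.range j, (N ^ i) f : F) : Closure k) ∈ ordGE k j) :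
    IsConstLinear fun f : F => (v f : Closure k) := by
  intro n c f g hc h
  rw [← sub_eq_zero]
  refine eq_zero_of_forall_mem_ordGE fun J => ?_
  choose M hM using fun i => exists_mul_mem_ordGE (c i)
  -- far enough in the series, the errors multiplied by the constants have order at least `J`
  have hev : ∀ᶠ j : ℕ in Filter.atTop, (J ≤ j) ∧ ∀ i, (J : ℤ) ≤ j - M i := by
    refine (Filter.eventually_ge_atTop J).and (Filter.eventually_all.2 fun i => ?_)
    filter_upwards [Filter.eventually_ge_atTop (J + M i).toNat] with j hj
    omega
  obtain ⟨j, hJj, hj⟩ := hev.exists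
  have hpart : ((∑ i ∈ Finset.range j, (N ^ i) g : F) : Closure k) =
      ∑ l, c l * ((∑ i ∈ Finset.range j, (N ^ i) (f l) : F) : Closure k) := by
    simp only [Submodule.coe_sum, Finset.mul_sum]
    rw [Finset.sum_comm]
    exact Finset.sum_congr rfl fun i _ => hC.pow i n c f g hc h
  have hsplit : (v g : Closure k) - ∑ l, c l * (v (f l) : Closure k) =
      ((v g : Closure k) - ((∑ i ∈ Finset.range j, (N ^ i) g : F) : Closure k)) -
      ∑ l, c l * ((v (f l) : Closure k) -
        ((∑ i ∈ Finset.range j, (N ^ i) (f l) : F) : Closure k)) := by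
    simp only [mul_sub, Finset.sum_sub_distrib]
    rw [hpart]
    ring
  rw [hsplit]
  refine sub_mem (ordGE_anti (by exact_mod_cast hJj) (hv j g)) (Submodule.sum_mem _ fun l _ => ?_)
  exact ordGE_anti (hj l) (hM l j _ (hv j (f l)))

end ConstLinear

/-! ### The function space and the normal form -/

theorem exists_linear_inverse_of_bijOn {k V W : Type*} [Semiring k] [AddCommMonoid V]
    [AddCommMonoid W] [Module k V] [Module k W] (A : V →ₗ[k] W) {H F : Submodule k V}
    {X : Submodule k W} (hHF : H ≤ F) (hA : Set.BijOn A (H : Set V) (X : Set W)) :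
    ∃ S : X →ₗ[k] F, ∀ f : X, (S f : V) ∈ H ∧ A (S f : V) = f := by
  let e : H ≃ₗ[k] X := LinearEquiv.ofBijective (A.restrict fun f hf => hA.mapsTo hf)
    ⟨fun f g hfg => Subtype.ext (hA.injOn f.2 g.2 (congrArg Subtype.val hfg)), fun g => by
      obtain ⟨f, hf, hfg⟩ := hA.surjOn g.2
      exact ⟨⟨f, hf⟩, Subtype.ext hfg⟩⟩
  exact ⟨Submodule.inclusion hHF ∘ₗ (e.symm : X →ₗ[k] H),
    fun f => ⟨(e.symm f).2, congrArg Subtype.val (e.apply_symm_apply f)⟩⟩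

section Spaces

variable {k : Type*} [Field k]

/-- The bound `m_ρ + ⋯ + m_{ρ+n-1}` on the first exponent in degree `n` of `F x`, for all integers
`n`. It is `0` for `n ≤ 0`, and the bound in degree `n` of `F` is its value at `n + 1`. -/
def expBound (L : DiffOp k) (ρ : k) (n : ℤ) : ℕ := ∑ i ∈ Finset.range n.toNat, mult L (ρ + i)

theorem expBound_of_nonpos (L : DiffOp k) (ρ : k) {n : ℤ} (hn : n ≤ 0) : expBound L ρ n = 0 := by
  rw [expBound, Int.toNat_of_nonpos hn, Finset.sum_range_zero]

theorem expBound_succ (L : DiffOp k) (ρ : k) {n : ℤ} (hn : 0 ≤ n) :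
    expBound L ρ (n + 1) = expBound L ρ n + mult L (n + ρ) := by
  lift n to ℕ using hn
  rw [expBound, expBound, Int.toNat_natCast_add_one, Int.toNat_natCast, Finset.sum_range_succ,
    Int.cast_natCast, add_comm ρ]

theorem expBound_mono (L : DiffOp k) (ρ : k) {m n : ℤ} (h : m ≤ n) :
    expBound L ρ m ≤ expBound L ρ n :=
  Finset.sum_le_sum_of_subset (Finset.range_mono (Int.toNat_le_toNat h))

variable {p : ℕ} {L : DiffOp k} {ρ : k}

theorem mem_rhoSpace {f : Closure k} : f ∈ rhoSpace p L ρ ↔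
    (∀ σ, σ ≠ ρ → f.coeff σ = 0) ∧ ∀ n : ℤ, coef ρ n f ∈ admSpan k p (expBound L ρ (n + 1)) := by
  have hset : ∀ n : ℤ, {α : ℕ →₀ ℕ | ∃ m : ℕ, n = m ∧ α ∈ expSet p L ρ m} =
      {α | α ∈ admissible p ∧ α 0 < expBound L ρ (n + 1)} := by
    intro n
    ext α
    constructor
    · rintro ⟨m, rfl, h1, h2⟩
      exact ⟨h2, by rwa [expBound, Int.toNat_natCast_add_one]⟩
    · rintro ⟨h1, h2⟩
      have hn : 0 ≤ n := by
        by_contra hn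
        rw [expBound_of_nonpos L ρ (by omega)] at h2
        omega
      lift n to ℕ using hn
      rw [expBound, Int.toNat_natCast_add_one] at h2
      exact ⟨n, rfl, h2, h1⟩
  refine and_congr_right fun _ => forall_congr' fun n => ?_
  beta_reduce
  rw [hset]
  rfl

theorem mem_complSpace {f : Closure k} : f ∈ complSpace p L ρ ↔
    (∀ σ, σ ≠ ρ → f.coeff σ = 0) ∧ ∀ n : ℤ, coef ρ n f ∈ Submodule.span k (zmon k ''
      {α | (α ∈ admissible p ∧ α 0 < expBound L ρ (n + 1)) ∧ mult L (n + ρ) ≤ weight p α}) := by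
  have hset : ∀ n : ℤ, {α : ℕ →₀ ℕ | ∃ m : ℕ, n = m ∧ α ∈ expSet p L ρ m ∧
      mult L (ρ + m) ≤ weight p α} = {α | (α ∈ admissible p ∧ α 0 < expBound L ρ (n + 1)) ∧
        mult L (n + ρ) ≤ weight p α} := by
    intro n
    ext α
    constructor
    · rintro ⟨m, rfl, ⟨h1, h2⟩, h3⟩
      exact ⟨⟨h2, by rwa [expBound, Int.toNat_natCast_add_one]⟩, by
        rwa [Int.cast_natCast, add_comm]⟩
    · rintro ⟨⟨h1, h2⟩, h3⟩
      have hn : 0 ≤ n := by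
        by_contra hn
        rw [expBound_of_nonpos L ρ (by omega)] at h2
        omega
      lift n to ℕ using hn
      rw [expBound, Int.toNat_natCast_add_one] at h2
      rw [Int.cast_natCast, add_comm] at h3
      exact ⟨n, rfl, ⟨h2, h1⟩, h3⟩
  refine and_congr_right fun _ => forall_congr' fun n => ?_
  beta_reduce
  rw [hset]
  rfl

theorem coef_single_one_mul (σ : k) (m n : ℤ) (f : Closure k) :
    coef σ n (AddMonoidAlgebra.single 0 (HahnSeries.single m 1) * f) = coef σ (n - m) f := by
  rw [coef_apply, AddMonoidAlgebra.coeff_single_mul_apply, neg_zero, zero_add,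
    HahnSeries.coeff_single_mul, one_mul, coef_apply]

theorem mem_rhoSpaceX {f : Closure k} : f ∈ rhoSpaceX p L ρ ↔
    (∀ σ, σ ≠ ρ → f.coeff σ = 0) ∧ ∀ n : ℤ, coef ρ n f ∈ admSpan k p (expBound L ρ n) := by
  have hsupp : ∀ (m : ℤ) (g : Closure k), (∀ σ, σ ≠ ρ → g.coeff σ = 0) → ∀ σ, σ ≠ ρ →
      (AddMonoidAlgebra.single 0 (HahnSeries.single m 1) * g : Closure k).coeff σ = 0 := by
    intro m g hg σ hσ
    rw [AddMonoidAlgebra.coeff_single_mul_apply, neg_zero, zero_add, hg σ hσ, mul_zero]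
  constructor
  · rintro ⟨g, hg, rfl⟩
    obtain ⟨hg1, hg2⟩ := mem_rhoSpace.1 hg
    refine ⟨hsupp 1 g hg1, fun n => ?_⟩
    have h := hg2 (n - 1)
    rw [sub_add_cancel] at h
    rw [LinearMap.mulLeft_apply, xvar, coef_single_one_mul]
    exact h
  · rintro ⟨h1, h2⟩
    refine ⟨AddMonoidAlgebra.single 0 (HahnSeries.single (-1) 1) * f,
      mem_rhoSpace.2 ⟨hsupp (-1) f h1, fun n => ?_⟩, ?_⟩
    · rw [coef_single_one_mul, sub_neg_eq_add]
      exact h2 (n + 1)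
    · refine ext_coef fun σ n => ?_
      rw [LinearMap.mulLeft_apply, xvar, coef_single_one_mul, coef_single_one_mul]
      rw [sub_neg_eq_add, sub_add_cancel]

theorem coef_eq_zero_of_coeff_eq_zero {f : Closure k} (h : ∀ σ, σ ≠ ρ → f.coeff σ = 0) {σ : k}
    (hσ : σ ≠ ρ) (n : ℤ) : coef σ n f = 0 := by
  rw [coef_apply, h σ hσ, HahnSeries.coeff_zero]

theorem coeff_eq_zero_of_coef_eq_zero {f : Closure k} {σ : k} (h : ∀ n, coef σ n f = 0) :
    f.coeff σ = 0 :=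
  HahnSeries.ext (funext h)

theorem complSpace_le_rhoSpace : complSpace p L ρ ≤ rhoSpace p L ρ := fun _ hf => by
  obtain ⟨h1, h2⟩ := mem_complSpace.1 hf
  exact mem_rhoSpace.2 ⟨h1, fun n =>
    Submodule.span_mono (Set.image_mono fun _ hα => hα.1) (h2 n)⟩

theorem rhoSpaceX_le_rhoSpace : rhoSpaceX p L ρ ≤ rhoSpace p L ρ := fun _ hf => by
  obtain ⟨h1, h2⟩ := mem_rhoSpaceX.1 hf
  exact mem_rhoSpace.2 ⟨h1, fun n => admSpan_mono (expBound_mono L ρ (by omega)) (h2 n)⟩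

theorem rhoSpace_le_ordGE : rhoSpace p L ρ ≤ ordGE k 0 := fun f hf σ n hn => by
  obtain ⟨h1, h2⟩ := mem_rhoSpace.1 hf
  by_cases hσ : σ = ρ
  · have h := h2 n
    rw [expBound_of_nonpos L ρ (by omega), admSpan_zero, Submodule.mem_bot] at h
    rw [hσ, h]
  · exact coef_eq_zero_of_coeff_eq_zero h1 hσ n

/-- A formal series in `t^ρ x^n`, `n ≥ 0`, with prescribed coefficients in `k(z)`. -/
theorem exists_coef_eq (ρ : k) (h : ℤ → ZField k) (h0 : ∀ n < 0, h n = 0) :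
    ∃ f : Closure k, (∀ σ, σ ≠ ρ → f.coeff σ = 0) ∧ ∀ n, coef ρ n f = h n := by
  refine ⟨AddMonoidAlgebra.single ρ (HahnSeries.ofSuppBddBelow h
    ⟨0, fun n hn => not_lt.1 fun h' => Function.mem_support.1 hn (h0 n h')⟩),
    fun σ hσ => ?_, fun n => ?_⟩
  · exact coeff_eq_zero_of_coef_eq_zero fun n => coef_single_of_ne hσ n _
  · rw [coef_single_self]
    rfl

/-- The space `F` is complete for the `x`-adic filtration. -/
theorem rhoSpace_complete (a : ℕ → Closure k) (ha : ∀ j, a j ∈ rhoSpace p L ρ)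
    (h : ∀ j : ℕ, a (j + 1) - a j ∈ ordGE k j) :
    ∃ g ∈ rhoSpace p L ρ, ∀ j : ℕ, g - a j ∈ ordGE k j := by
  have hstable : ∀ (σ : k) (n : ℤ) (i j : ℕ), n < i → i ≤ j → coef σ n (a j) = coef σ n (a i) := by
    intro σ n i j hi hij
    induction hij with
    | refl => rfl
    | @step j hij ih =>
      have hij' : i ≤ j := hij
      have h1 := h j σ n (by omega)
      rw [map_sub, sub_eq_zero] at h1
      exact h1.trans ih
  -- the coefficient of degree `n` is stationary from the index `n + 1` on
  obtain ⟨g, hg1, hg2⟩ := exists_coef_eq ρ (fun n => coef ρ n (a (n + 1).toNat))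
    (fun n hn => rhoSpace_le_ordGE (ha _) ρ n hn)
  refine ⟨g, mem_rhoSpace.2 ⟨hg1, fun n => ?_⟩, fun j σ n hn => ?_⟩
  · rw [hg2]
    exact (mem_rhoSpace.1 (ha _)).2 n
  · rw [map_sub, sub_eq_zero]
    by_cases hσ : σ = ρ
    · rw [hσ, hg2]
      rcases lt_or_ge n 0 with h0 | h0
      · rw [rhoSpace_le_ordGE (ha _) ρ n h0, rhoSpace_le_ordGE (ha _) ρ n h0]
      · exact (hstable ρ n _ j (by omega) (by omega)).symm
    · rw [coef_eq_zero_of_coeff_eq_zero hg1 hσ,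
        coef_eq_zero_of_coeff_eq_zero (mem_rhoSpace.1 (ha j)).1 hσ]

variable [hp : Fact p.Prime] [CharP k p]

theorem act_eulerPart_mem_rhoSpaceX (hL : HasShift L 0) {f : Closure k}
    (hf : f ∈ rhoSpace p L ρ) : act (eulerPart L 0) f ∈ rhoSpaceX p L ρ := by
  obtain ⟨h1, h2⟩ := mem_rhoSpace.1 hf
  refine mem_rhoSpaceX.2 ⟨fun σ hσ => coeff_eq_zero_of_coef_eq_zero fun n => ?_, fun n => ?_⟩
  · rw [coef_act_eulerPart, coef_eq_zero_of_coeff_eq_zero h1 hσ, map_zero]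
  · rw [coef_act_eulerPart]
    rcases lt_or_ge n 0 with h0 | h0
    · rw [rhoSpace_le_ordGE hf ρ n h0, map_zero]
      exact zero_mem _
    · have h := h2 n
      rw [expBound_succ L ρ h0] at h
      exact aeval_zShift_mem_admSpan (indicial_ne_zero hL) _ h

theorem exists_act_eulerPart_eq (hL : HasShift L 0) {g : Closure k}
    (hg : g ∈ rhoSpaceX p L ρ) : ∃ f ∈ complSpace p L ρ, act (eulerPart L 0) f = g := by
  obtain ⟨h1, h2⟩ := mem_rhoSpaceX.1 hg
  have hex : ∀ n : ℤ, ∃ h : ZField k, (n < 0 → h = 0) ∧ h ∈ Submodule.span k (zmon k ''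
      {α | (α ∈ admissible p ∧ α 0 < expBound L ρ (n + 1)) ∧ mult L (n + ρ) ≤ weight p α}) ∧
      Polynomial.aeval (zShift (n + ρ)) (indicial L) h = coef ρ n g := by
    intro n
    rcases lt_or_ge n 0 with h0 | h0
    · exact ⟨0, fun _ => rfl, zero_mem _, by
        rw [rhoSpace_le_ordGE (rhoSpaceX_le_rhoSpace hg) ρ n h0, map_zero]⟩
    · obtain ⟨h, hh, heq⟩ := exists_aeval_zShift_apply_eq (indicial_ne_zero hL) (n + ρ) (h2 n)
      rw [expBound_succ L ρ h0]
      exact ⟨h, fun h' => by omega, hh, heq⟩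
  choose h hh0 hh heq using hex
  obtain ⟨f, hf1, hf2⟩ := exists_coef_eq ρ h hh0
  refine ⟨f, mem_complSpace.2 ⟨hf1, fun n => by rw [hf2]; exact hh n⟩, ext_coef fun σ n => ?_⟩
  rw [coef_act_eulerPart]
  by_cases hσ : σ = ρ
  · rw [hσ, hf2, heq]
  · rw [coef_eq_zero_of_coeff_eq_zero hf1 hσ, coef_eq_zero_of_coeff_eq_zero h1 hσ, map_zero]

omit hp [CharP k p] in
theorem coef_mem_constSpan_of_mem_complSpace {f : Closure k} (hf : f ∈ complSpace p L ρ) (n : ℤ) :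
    coef ρ n f ∈ constSpan k p (mult L (n + ρ)) :=
  span_le_constSpan (fun _ hα => ⟨hα.1.1, hα.2⟩) ((mem_complSpace.1 hf).2 n)

theorem coef_eq_zero_of_act_eulerPart (hL : HasShift L 0) {f : Closure k} {σ : k} {n : ℤ}
    (hf : coef σ n f ∈ constSpan k p (mult L (n + σ)))
    (h0 : coef σ n (act (eulerPart L 0) f) = 0) : coef σ n f = 0 := by
  rw [coef_act_eulerPart] at h0
  exact eq_zero_of_aeval_zShift_eq_zero (indicial_ne_zero hL) _ hf h0

theorem eq_zero_of_mem_complSpace (hL : HasShift L 0) {f : Closure k}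
    (hf : f ∈ complSpace p L ρ) (h0 : act (eulerPart L 0) f = 0) : f = 0 := by
  refine ext_coef fun σ n => ?_
  rw [map_zero]
  by_cases hσ : σ = ρ
  · rw [hσ]
    exact coef_eq_zero_of_act_eulerPart hL (coef_mem_constSpan_of_mem_complSpace hf n)
      (by rw [h0, map_zero])
  · exact coef_eq_zero_of_coeff_eq_zero (mem_complSpace.1 hf).1 hσ n

/-- The initial form is injective on the module over the constants generated by the complement. -/
theorem eq_sum_of_act_eulerPart_eq (hL : HasShift L 0) {n : ℕ} {c f : Fin n → Closure k}
    {g : Closure k} (hc : ∀ i, del k (c i) = 0) (hf : ∀ i, f i ∈ complSpace p L ρ)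
    (hg : g ∈ complSpace p L ρ)
    (h : act (eulerPart L 0) g = ∑ i, c i * act (eulerPart L 0) (f i)) : g = ∑ i, c i * f i := by
  rw [← sub_eq_zero]
  refine ext_coef fun σ l => ?_
  rw [map_zero]
  have hmem : ∀ (d e : Closure k), del k d = 0 → e ∈ complSpace p L ρ →
      coef σ l (d * e) ∈ constSpan k p (mult L (l + σ)) := fun d e hd he =>
    coef_const_mul_mem hd (mem_complSpace.1 he).1 (coef_mem_constSpan_of_mem_complSpace he) σ l
  refine coef_eq_zero_of_act_eulerPart (p := p) hL ?_ ?_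
  · rw [map_sub, map_sum]
    refine sub_mem ?_ (Submodule.sum_mem _ fun i _ => hmem _ _ (hc i) (hf i))
    have := hmem 1 g (del k).map_one_eq_zero hg
    rwa [one_mul] at this
  · rw [map_sub, h, map_sum, Finset.sum_congr rfl fun i _ => act_const_mul _ (hc i) (f i),
      sub_self, map_zero]

theorem act_eulerPart_sub_act_mem (hL : HasShift L 0) {f : Closure k} (hf : f ∈ rhoSpace p L ρ) :
    act (eulerPart L 0) f - act L f ∈ rhoSpaceX p L ρ := by
  obtain ⟨h1, h2⟩ := mem_rhoSpace.1 hf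
  refine mem_rhoSpaceX.2 ⟨fun σ hσ => coeff_eq_zero_of_coef_eq_zero fun n => ?_, fun n => ?_⟩
  · refine (Submodule.mem_bot k).1 (coef_act_eulerPart_sub_act_mem hL ⊥ ?_ fun n' _ => ?_)
    · intro g hg
      rw [(Submodule.mem_bot k).1 hg, map_zero]
      exact zero_mem _
    · rw [coef_eq_zero_of_coeff_eq_zero h1 hσ]
      exact zero_mem _
  · exact coef_act_eulerPart_sub_act_mem hL _ (fun g hg => zEnd_stable_admSpan hg)
      fun n' hn' => admSpan_mono (expBound_mono L ρ (by omega)) (h2 n')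

omit hp [CharP k p] in
theorem act_eulerPart_sub_act_mem_ordGE (hL : HasShift L 0) {f : Closure k} {N : ℤ}
    (hf : f ∈ ordGE k N) : act (eulerPart L 0) f - act L f ∈ ordGE k (N + 1) := by
  intro σ n hn
  refine (Submodule.mem_bot k).1 (coef_act_eulerPart_sub_act_mem hL ⊥ ?_ fun n' hn' => ?_)
  · intro g hg
    rw [(Submodule.mem_bot k).1 hg, map_zero]
    exact zero_mem _
  · rw [hf σ n' (by omega)]
    exact zero_mem _

theorem mem_ordGE_of_act_eulerPart (hL : HasShift L 0) {f : Closure k} {N : ℤ}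
    (hf : f ∈ complSpace p L ρ) (h : act (eulerPart L 0) f ∈ ordGE k N) : f ∈ ordGE k N := by
  intro σ n hn
  by_cases hσ : σ = ρ
  · subst hσ
    exact coef_eq_zero_of_act_eulerPart hL (coef_mem_constSpan_of_mem_complSpace hf n) (h _ n hn)
  · exact coef_eq_zero_of_coeff_eq_zero (mem_complSpace.1 hf).1 hσ n

theorem bijOn_act_eulerPart (hL : HasShift L 0) : Set.BijOn (act (eulerPart L 0))
    (complSpace p L ρ : Set (Closure k)) (rhoSpaceX p L ρ : Set (Closure k)) := by
  refine ⟨fun f hf => act_eulerPart_mem_rhoSpaceX hL (complSpace_le_rhoSpace hf),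
    fun f hf g hg hfg => ?_, fun g hg => exists_act_eulerPart_eq hL hg⟩
  refine sub_eq_zero.1 (eq_zero_of_mem_complSpace hL (sub_mem hf hg) ?_)
  rw [map_sub, sub_eq_zero]
  exact hfg

/-- The right inverse of the initial form with values in the complement. -/
theorem exists_rightInverse (hL : HasShift L 0) : ∃ S : rhoSpaceX p L ρ →ₗ[k] rhoSpace p L ρ,
    ∀ f : rhoSpaceX p L ρ,
      (S f : Closure k) ∈ complSpace p L ρ ∧ act (eulerPart L 0) (S f : Closure k) = f :=
  exists_linear_inverse_of_bijOn _ complSpace_le_rhoSpace (bijOn_act_eulerPart hL)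

theorem exists_eulerPart_sub_act (p : ℕ) [Fact p.Prime] [CharP k p] (hL : HasShift L 0) :
    ∃ T : rhoSpace p L ρ →ₗ[k] rhoSpaceX p L ρ, ∀ f : rhoSpace p L ρ,
      (T f : Closure k) = act (eulerPart L 0) (f : Closure k) - act L (f : Closure k) :=
  ⟨(act (eulerPart L 0) - act L).restrict fun _ hf => act_eulerPart_sub_act_mem hL hf,
    fun _ => rfl⟩

end Spaces

end EulerClosure

end

theorem theorem3p11 (p : ℕ) [Fact p.Prime] (k : Type*) [Field k] [CharP k p] [IsAlgClosed k]
    (L L₀ : DiffOp k) (hL : HasShift L 0) (hL₀ : L₀ = eulerPart L 0)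
    (ρ : k) (hρ : (indicial L).IsRoot ρ) :
    -- `H` is a direct complement in `F` of the kernel of `L₀` on `F`
    (complSpace p L ρ ⊓ LinearMap.ker (act L₀) = ⊥ ∧
      complSpace p L ρ ⊔ rhoSpace p L ρ ⊓ LinearMap.ker (act L₀) = rhoSpace p L ρ) ∧
    -- (i): `L₀ : H → F x` is bijective, and its inverse is a `C`-linear right inverse `S` of `L₀`
    Set.BijOn (act L₀) (complSpace p L ρ : Set (Closure k)) (rhoSpaceX p L ρ : Set (Closure k)) ∧
    ∃ S : rhoSpaceX p L ρ →ₗ[k] rhoSpace p L ρ,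
      (∀ f : rhoSpaceX p L ρ,
        (S f : Closure k) ∈ complSpace p L ρ ∧ act L₀ (S f : Closure k) = f) ∧
      IsConstLinear (fun f : rhoSpaceX p L ρ => (S f : Closure k)) ∧
      -- (ii): `T = L₀ - L` maps `F` to `F x`, and `u = Id - S ∘ T` is a continuous `C`-linear
      -- automorphism of `F` with inverse `∑ (S ∘ T)^n`
      ∃ T : rhoSpace p L ρ →ₗ[k] rhoSpaceX p L ρ,
        (∀ f : rhoSpace p L ρ,
          (T f : Closure k) = act L₀ (f : Closure k) - act L (f : Closure k)) ∧
        ∃ u : rhoSpace p L ρ ≃L[k] rhoSpace p L ρ,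
          (∀ f : rhoSpace p L ρ, u f = f - S (T f)) ∧
          IsConstLinear (fun f : rhoSpace p L ρ => (u f : Closure k)) ∧
          IsConstLinear (fun f : rhoSpace p L ρ => (u.symm f : Closure k)) ∧
          (∀ f : rhoSpace p L ρ, HasSum (fun n : ℕ => ((S ∘ₗ T) ^ n) f) (u.symm f)) ∧
          -- (iii): `L ∘ u⁻¹ = L₀` on `F`
          ∀ f : rhoSpace p L ρ,
            act L (u.symm f : Closure k) = act L₀ (f : Closure k) := by
  subst hL₀
  refine ⟨⟨?_, ?_⟩, bijOn_act_eulerPart hL, ?_⟩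
  · rw [eq_bot_iff]
    rintro f ⟨hf, h0⟩
    exact eq_zero_of_mem_complSpace hL hf h0
  · refine le_antisymm (sup_le complSpace_le_rhoSpace inf_le_left) fun f hf => ?_
    obtain ⟨h, hh, hfh⟩ := exists_act_eulerPart_eq hL (act_eulerPart_mem_rhoSpaceX hL hf)
    refine Submodule.mem_sup.2 ⟨h, hh, f - h, ⟨sub_mem hf (complSpace_le_rhoSpace hh), ?_⟩,
      add_sub_cancel _ _⟩
    change act (eulerPart L 0) (f - h) = 0
    rw [map_sub, hfh, sub_self]
  obtain ⟨S, hS⟩ := exists_rightInverse (p := p) (ρ := ρ) hL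
  have hSC : IsConstLinear (fun f : rhoSpaceX p L ρ => (S f : Closure k)) := by
    intro n c f g hc hg
    refine eq_sum_of_act_eulerPart_eq hL hc (fun i => (hS (f i)).1) (hS g).1 ?_
    rw [(hS g).2, hg]
    exact Finset.sum_congr rfl fun i _ => by rw [(hS (f i)).2]
  obtain ⟨T, hT⟩ := exists_eulerPart_sub_act (ρ := ρ) p hL
  have hNC : IsConstLinear (fun f : rhoSpace p L ρ => ((S ∘ₗ T) f : Closure k)) := by
    intro n c f g hc hg
    refine hSC n c (fun i => T (f i)) (T g) hc ?_
    rw [hT, hg, map_sum, map_sum, ← Finset.sum_sub_distrib]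
    refine Finset.sum_congr rfl fun i _ => ?_
    rw [act_const_mul _ (hc i), act_const_mul _ (hc i), hT, mul_sub]
  have hN : ∀ (j : ℤ) (f : rhoSpace p L ρ), (f : Closure k) ∈ ordGE k j →
      ((S ∘ₗ T) f : Closure k) ∈ ordGE k (j + 1) := by
    intro j f hf
    refine mem_ordGE_of_act_eulerPart hL (hS (T f)).1 ?_
    have h1 := act_eulerPart_sub_act_mem_ordGE hL hf
    rw [← hT, ← (hS (T f)).2] at h1
    exact h1
  obtain ⟨u, hu, happrox, hsum⟩ := exists_equiv_sub_of_submodule (fun _ _ => ordGE_anti)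
    hasBasis_nhds (fun _ => eq_zero_of_forall_mem_ordGE) rhoSpace_le_ordGE rhoSpace_complete
    (S ∘ₗ T) hN
  refine ⟨S, hS, hSC, T, hT, u, fun f => Subtype.ext (hu f), fun n c f g hc hg => ?_,
    isConstLinear_of_sub_sum_mem_ordGE hNC happrox, hsum, fun f => ?_⟩
  · simp only [hu]
    rw [show ((S ∘ₗ T) g : Closure k) = _ from hNC n c f g hc hg, hg, ← Finset.sum_sub_distrib]
    exact Finset.sum_congr rfl fun i _ => (mul_sub _ _ _).symm
  · have h1 : (f : Closure k) = u.symm f - (S (T (u.symm f)) : Closure k) :=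
      (congrArg Subtype.val (u.apply_symm_apply f)).symm.trans
        (hu (u.symm f))
    rw [h1, map_sub, (hS _).2, hT, sub_sub_cancel]
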